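/- Let $\Omega_0,\Omega_1$ be Polish spaces with their Borel $\sigma$-algebras, let $\mathcal E\subseteq\Omega_0\times\Omega_1$ be closed, and assume that every $x\in\Omega_0$ has some $y\in\Omega_1$ with $(x,y)\in\mathcal E$ and every $y\in\Omega_1$ has some $x\in\Omega_0$ with $(x,y)\in\mathcal E$. Let $\nu_0,\nu_1$ be finite Borel measures of positive total mass on $\Omega_0,\Omega_1$. Fix $\iota\in\{0,1\}$, put $\bar\iota:=1-\iota$, and let $\mathrm{pr}_0,\mathrm{pr}_1$ be the coordinate projections of $\Omega_0\times\Omega_1$. Let $\Pi_\iota$ be the set of finite Borel measures $\pi$ on $\Omega_0\times\Omega_1$ with $\pi(\mathcal E^c)=0$ and $(\mathrm{pr}_\iota)_\#\pi=\nu_\iota$ (the refinements of $\nu_\iota$). For $\pi\in\Pi_\iota$ write the Lebesgue decomposition of its opposite marginal as $(\mathrm{pr}_{\bar\iota})_\#\pi=r\,\nu_{\bar\iota}+P^\perp$ with $P^\perp\perp\nu_{\bar\iota}$. For $t\ge 0$ let $\mathrm{Fit}_{\bar\iota}(t)$ be the supremum of $\sigma(\Omega_0\times\Omega_1)$ over all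 finite Borel measures $\sigma$ on $\Omega_0\times\Omega_1$ with $\sigma(\mathcal E^c)=0$, $(\mathrm{pr}_\iota)_\#\sigma\le\nu_\iota$ and $(\mathrm{pr}_{\bar\iota})_\#\sigma\le t\,\nu_{\bar\iota}$. Call $\pi\in\Pi_\iota$ level-optimal maximin if $$\int_{\Omega_{\bar\iota}}\min(r,t)\,d\nu_{\bar\iota}=\mathrm{Fit}_{\bar\iota}(t)\qquad\text{for all }t\ge 0.$$ For a proper convex lower semicontinuous $\vartheta:[0,\infty)\to\mathbb R\cup\{+\infty\}$ with recession slope $\vartheta'_\infty:=\lim_{t\to\infty}\vartheta(t)/t\in\mathbb R\cup\{+\infty\}$, put $$\mathsf D_\vartheta\bigl((\mathrm{pr}_{\bar\iota})_\#\pi\,\|\,\nu_{\bar\iota}\bigr):=\int_{\Omega_{\bar\iota}}\vartheta(r)\,d\nu_{\bar\iota}+\vartheta'_\infty\,P^\perp(\Omega_{\bar\iota}),\qquad (+\infty)\cdot 0:=0.$$ **Theorem.** (1) Let $\vartheta:[0,\infty)\to\mathbb R\cup\{+\infty\}$ be proper, lower semicontinuous, and strictly convex on its effective domain $\{\vartheta<+\infty\}$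 (in particular, this domain is convex). If $\pi^\star\in\Pi_\iota$ satisfies $$\mathsf D_\vartheta\bigl((\mathrm{pr}_{\bar\iota})_\#\pi^\star\,\|\,\nu_{\bar\iota}\bigr)=\inf_{\pi\in\Pi_\iota}\mathsf D_\vartheta\bigl((\mathrm{pr}_{\bar\iota})_\#\pi\,\|\,\nu_{\bar\iota}\bigr)<+\infty,$$ then $\pi^\star$ is level-optimal maximin. (2) A level-optimal maximin $\pi\in\Pi_\iota$ exists. -/

import Mathlib

open MeasureTheory Filter
open scoped ENNReal NNReal

/-- The two vertex spaces are indexed by the sides `false` (side `0`) and `true` (side `1`);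
`!ι` is the side opposite to `ι`.  `sideProj ι` is the projection of `Ω₀ × Ω₁` to side `ι`. -/
def sideProj {Ω : Bool → Type*} : (ι : Bool) → Ω false × Ω true → Ω ι
  | false => Prod.fst
  | true => Prod.snd

/-- Allocation refinements of `ν ι`: finite measures on `Ω₀ × Ω₁` carried by the edge set `E`
whose `ι`-marginal is `ν ι`. -/
def allocationRefinements {Ω : Bool → Type*} [∀ ι, MeasurableSpace (Ω ι)]
    (E : Set (Ω false × Ω true)) (ν : ∀ ι, Measure (Ω ι)) (ι : Bool) :
    Set (Measure (Ω false × Ω true)) :=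
  {π | IsFiniteMeasure π ∧ π Eᶜ = 0 ∧ π.map (sideProj ι) = ν ι}

/-- The payload of a plan `π` of side `ι`: its marginal on the opposite side. -/
noncomputable def payload {Ω : Bool → Type*} [∀ ι, MeasurableSpace (Ω ι)]
    (ι : Bool) (π : Measure (Ω false × Ω true)) : Measure (Ω (!ι)) :=
  π.map (sideProj (!ι))

/-- The integral of an extended-real-valued function, as the integral of the positive part minus
the integral of the negative part. -/
noncomputable def extIntegral {X : Type*} [MeasurableSpace X] (f : X → EReal) (μ : Measure X) :
    EReal :=
  ((∫⁻ x, (f x).toENNReal ∂μ : ℝ≥0∞) : EReal) - ((∫⁻ x, (-f x).toENNReal ∂μ : ℝ≥0∞) : EReal)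

/-- The recession slope `lim_{t → ∞} θ t / t`.  The limit exists in `(-∞, +∞]` for every proper
convex `θ`, and then it is the upper limit used here. -/
noncomputable def recessionSlope (θ : ℝ≥0 → EReal) : EReal :=
  limsup (fun t : ℝ≥0 => θ t / ((t : ℝ) : EReal)) atTop

/-- The `θ`-divergence of `P` from `Q`: the integral of `θ` of the density of the absolutely
continuous part, plus the recession slope times the mass of the singular part.
In `EReal` one has `⊤ * 0 = 0`, and `⊤ * m = ⊤` for `m > 0`. -/
noncomputable def thetaDivergence {X : Type*} [MeasurableSpace X] (θ : ℝ≥0 → EReal)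
    (P Q : Measure X) : EReal :=
  extIntegral (fun x => θ (P.rnDeriv Q x).toNNReal) Q
    + recessionSlope θ * ((P.singularPart Q Set.univ : ℝ≥0∞) : EReal)

/-- `π` is a closest one-sided refinement on side `ι` for the divergence `D`. -/
def IsClosestOneSidedRefinement {Ω : Bool → Type*} [∀ ι, MeasurableSpace (Ω ι)]
    (E : Set (Ω false × Ω true)) (ν : ∀ ι, Measure (Ω ι)) (ι : Bool)
    (D : Measure (Ω (!ι)) → Measure (Ω (!ι)) → EReal) (π : Measure (Ω false × Ω true)) : Prop :=
  π ∈ allocationRefinements E ν ι ∧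
    D (payload ι π) (ν (!ι)) = ⨅ π' ∈ allocationRefinements E ν ι, D (payload ι π') (ν (!ι))

/-- The subplans of `ν ι` whose shipment to the opposite side stays below `t • ν (!ι)`. -/
def feasibleSubplans {Ω : Bool → Type*} [∀ ι, MeasurableSpace (Ω ι)]
    (E : Set (Ω false × Ω true)) (ν : ∀ ι, Measure (Ω ι)) (ι : Bool) (t : ℝ≥0) :
    Set (Measure (Ω false × Ω true)) :=
  {σ | IsFiniteMeasure σ ∧ σ Eᶜ = 0 ∧ σ.map (sideProj ι) ≤ ν ι ∧
    σ.map (sideProj (!ι)) ≤ t • ν (!ι)}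

/-- The largest total mass that can be packed below level `t` on the side opposite to `ι`. -/
noncomputable def fitMass {Ω : Bool → Type*} [∀ ι, MeasurableSpace (Ω ι)]
    (E : Set (Ω false × Ω true)) (ν : ∀ ι, Measure (Ω ι)) (ι : Bool) (t : ℝ≥0) : ℝ≥0∞ :=
  ⨆ σ ∈ feasibleSubplans E ν ι t, σ Set.univ

/-- The absolutely continuous payload truncated at level `t`: the measure `(r ∧ t) ν (!ι)`, where
`r` is the density of the absolutely continuous part of the payload with respect to `ν (!ι)`. -/
noncomputable def truncatedPayload {Ω : Bool → Type*} [∀ ι, MeasurableSpace (Ω ι)]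
    (ν : ∀ ι, Measure (Ω ι)) (ι : Bool) (π : Measure (Ω false × Ω true)) (t : ℝ≥0) :
    Measure (Ω (!ι)) :=
  (ν (!ι)).withDensity (fun y => min ((payload ι π).rnDeriv (ν (!ι)) y) (t : ℝ≥0∞))

/-- `π` is a level-optimal maximin refinement from side `ι` to the opposite side. -/
def IsLevelOptimalMaximin {Ω : Bool → Type*} [∀ ι, MeasurableSpace (Ω ι)]
    (E : Set (Ω false × Ω true)) (ν : ∀ ι, Measure (Ω ι)) (ι : Bool)
    (π : Measure (Ω false × Ω true)) : Prop :=
  π ∈ allocationRefinements E ν ι ∧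
    ∀ t : ℝ≥0, truncatedPayload ν ι π t Set.univ = fitMass E ν ι t

/-- The effective domain of an extended-real-valued function on `[0, ∞)`. -/
def effDomain (θ : ℝ≥0 → EReal) : Set ℝ≥0 := {t | θ t ≠ ⊤}

/-- A proper function `[0, ∞) → ℝ ∪ {+∞}`: it never takes the value `-∞` and is finite
somewhere. -/
def IsProperFun (θ : ℝ≥0 → EReal) : Prop :=
  (∀ t, θ t ≠ ⊥) ∧ (effDomain θ).Nonempty

/-!
The two coordinate projections are treated as maps `p : Z → X` and `q : Z → Y` on the space `Z` of
pairs, with `p` the projection to the side `ι` and `q` the opposite one.  A refinement is a lift of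
`μ = ν ι` along `p` that is carried by `E`; write `P` for its image under `q` and `r` for the
density of `P` with respect to `ν = ν (!ι)`.

**Minimizers are level-optimal.**  Let `π` minimize a strictly convex divergence.  If some plan on
`E` could take mass that `π` ships to `{r ≥ b}` or to the singular part and ship it to `{r ≤ a}`
instead, with `a < b`, then doing so at a small rate would bring the density closer to the level
`(a + b) / 2` everywhere, without enlarging the singular part.  Comparison with a supporting line
at that level shows that the divergence would strictly decrease
(`thetaDivergence_lt_of_between`, `eq_zero_of_transfer_of_minimizer`).  Fix a level `t`, and let `H`
be the set of sources from which `π` ships to `{r ≥ t}` or to the singular part.  A subplan `σ`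
below level `t` ships nothing from `H` to `{r < t}`, so its mass is at most `t ν{r ≥ t} + μ(Hᶜ)`.
Since `π` ships all of `μ` on `Hᶜ` into `{r < t}`, this is at most `∫ min r t dν`
(`measure_univ_le_lintegral_min_of_minimizer`).  Conversely the part of `π` below level `t` is
itself a subplan (`exists_subplan_mass_eq_lintegral_min`).

**Existence.**  It remains to find a minimizer for one strictly convex function, and `exp (-t)` is
convenient: it is bounded, has recession slope zero, and its defect of convexity is a square, so
that the functions `exp (-r / 2)` of a minimizing sequence are Cauchy in `L²`
(`integral_sq_sub_exp_half_eq`).  Hence the densities converge almost everywhere along a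
subsequence.  Off small sets the densities are uniformly bounded, so the plans are tight there,
and Prokhorov's theorem gives limit plans with the limiting density.  Mass of `μ` that is lost in
the limit is put back along a measurable section of `p` over `E`
(`exists_mem_liftsAlong_withDensity_le`), which exists almost everywhere because the Polish space
`E` is exhausted in measure by compact sets (`IsClosed.exists_measurable_ae_section`).  This can
only increase the density, hence only decrease the cost.
-/

/-! ### Strictly convex functions on the half-line -/

/-- Strict convexity at three points, cleared of denominators. -/
lemma StrictConvexOn.three_point_nnreal {D : Set ℝ≥0} {f : ℝ≥0 → ℝ} (hf : StrictConvexOn ℝ≥0 D f)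
    {x c z : ℝ≥0} (hx : x ∈ D) (hz : z ∈ D) (hxc : x < c) (hcz : c < z) :
    c ∈ D ∧ ((z : ℝ) - x) * f c < ((z : ℝ) - c) * f x + ((c : ℝ) - x) * f z := by
  have hxz : x < z := hxc.trans hcz
  have hd : 0 < z - x := tsub_pos_of_lt hxz
  have ha : 0 < (z - c) / (z - x) := div_pos (tsub_pos_of_lt hcz) hd
  have hb : 0 < (c - x) / (z - x) := div_pos (tsub_pos_of_lt hxc) hd
  have h1 : (x : ℝ) < c := by exact_mod_cast hxc
  have h2 : (c : ℝ) < z := by exact_mod_cast hcz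
  have hdr : (0 : ℝ) < (z : ℝ) - x := by linarith
  have hab : (z - c) / (z - x) + (c - x) / (z - x) = 1 := by
    apply NNReal.eq
    push_cast [NNReal.coe_sub hcz.le, NNReal.coe_sub hxc.le, NNReal.coe_sub hxz.le]
    field_simp
    ring
  have hc : ((z - c) / (z - x)) • x + ((c - x) / (z - x)) • z = c := by
    apply NNReal.eq
    simp only [smul_eq_mul]
    push_cast [NNReal.coe_sub hcz.le, NNReal.coe_sub hxc.le, NNReal.coe_sub hxz.le]
    field_simp
    ring
  refine ⟨hc ▸ hf.1 hx hz ha.le hb.le hab, ?_⟩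
  have := hf.2 hx hz hxz.ne ha hb hab
  rw [hc] at this
  simp only [NNReal.smul_def, smul_eq_mul] at this
  push_cast [NNReal.coe_sub hcz.le, NNReal.coe_sub hxc.le, NNReal.coe_sub hxz.le] at this
  have h3 := mul_lt_mul_of_pos_left this hdr
  calc ((z : ℝ) - x) * f c < _ := h3
    _ = _ := by field_simp

/-- A strictly convex function has a strictly supporting line at each point with domain points on
both sides. -/
lemma StrictConvexOn.exists_strict_support {D : Set ℝ≥0} {f : ℝ≥0 → ℝ}
    (hf : StrictConvexOn ℝ≥0 D f) {x₀ c z₀ : ℝ≥0} (hx₀ : x₀ ∈ D) (hz₀ : z₀ ∈ D)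
    (h₁ : x₀ < c) (h₂ : c < z₀) :
    ∃ m : ℝ, ∀ x ∈ D, x ≠ c → f c + m * ((x : ℝ) - c) < f x := by
  obtain ⟨m, hm₁, hm₂⟩ := exists_between_of_forall_le
    (s := {s : ℝ | ∃ x ∈ D, x < c ∧ s = (f c - f x) / ((c : ℝ) - x)})
    (t := {s : ℝ | ∃ z ∈ D, c < z ∧ s = (f z - f c) / ((z : ℝ) - c)})
    ⟨_, x₀, hx₀, h₁, rfl⟩ ⟨_, z₀, hz₀, h₂, rfl⟩ (by
      rintro _ ⟨x, hx, hxc, rfl⟩ _ ⟨z, hz, hcz, rfl⟩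
      have h := (hf.three_point_nnreal hx hz hxc hcz).2
      have h1 : (x : ℝ) < c := by exact_mod_cast hxc
      have h2 : (c : ℝ) < z := by exact_mod_cast hcz
      rw [div_le_div_iff₀ (by linarith) (by linarith)]
      nlinarith)
  have hweak : ∀ x ∈ D, f c + m * ((x : ℝ) - c) ≤ f x := by
    intro x hx
    rcases lt_trichotomy x c with hxc | rfl | hcx
    · have h := hm₁ ⟨x, hx, hxc, rfl⟩
      have h1 : (x : ℝ) < c := by exact_mod_cast hxc
      rw [div_le_iff₀ (by linarith)] at h
      linarith
    · simp
    · have h := hm₂ ⟨x, hx, hcx, rfl⟩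
      have h1 : (c : ℝ) < x := by exact_mod_cast hcx
      rw [le_div_iff₀ (by linarith)] at h
      linarith
  refine ⟨m, fun x hx hxc => ?_⟩
  have hcD : c ∈ D := (hf.three_point_nnreal hx₀ hz₀ h₁ h₂).1
  -- Strictness comes from comparing the weak inequality at the midpoint of `x` and `c`.
  have key : ∀ w : ℝ≥0, w ∈ D → (w : ℝ) = ((x : ℝ) + c) / 2 → 2 * f w < f x + f c →
      f c + m * ((x : ℝ) - c) < f x := by
    intro w hw hwe hlt
    have := hweak w hw
    rw [hwe] at this
    linarith
  have hmid : ((((x + c) / 2 : ℝ≥0)) : ℝ) = ((x : ℝ) + c) / 2 := by push_cast; rfl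
  rcases lt_or_gt_of_ne hxc with hlt | hlt
  · have h1 : (x : ℝ) < c := by exact_mod_cast hlt
    have h := hf.three_point_nnreal (c := (x + c) / 2) hx hcD
      (by rw [← NNReal.coe_lt_coe, hmid]; linarith) (by rw [← NNReal.coe_lt_coe, hmid]; linarith)
    refine key _ h.1 hmid ?_
    have h2 := h.2
    rw [hmid] at h2
    nlinarith
  · have h1 : (c : ℝ) < x := by exact_mod_cast hlt
    have h := hf.three_point_nnreal (c := (x + c) / 2) hcD hx
      (by rw [← NNReal.coe_lt_coe, hmid]; linarith) (by rw [← NNReal.coe_lt_coe, hmid]; linarith)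
    refine key _ h.1 hmid ?_
    have h2 := h.2
    rw [hmid] at h2
    nlinarith

/-- Moving a point towards `c` changes a strictly convex function by less than the slope of a
supporting line at `c` predicts. -/
lemma StrictConvexOn.lt_of_between {D : Set ℝ≥0} {f : ℝ≥0 → ℝ}
    (hf : StrictConvexOn ℝ≥0 D f) {c : ℝ≥0} (hc : c ∈ D) {m : ℝ}
    (hm : ∀ x ∈ D, x ≠ c → f c + m * ((x : ℝ) - c) < f x)
    {x x' : ℝ≥0} (hx : x ∈ D) (hne : x' ≠ x) (hb : (x ≤ x' ∧ x' ≤ c) ∨ (c ≤ x' ∧ x' ≤ x)) :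
    x' ∈ D ∧ f x' < f x + m * ((x' : ℝ) - x) := by
  rcases eq_or_ne x' c with rfl | hxc
  · refine ⟨hc, ?_⟩
    have := hm x hx hne.symm
    linarith
  rcases hb with ⟨h1, h2⟩ | ⟨h1, h2⟩
  · have h1 : x < x' := lt_of_le_of_ne h1 hne.symm
    have h2 : x' < c := lt_of_le_of_ne h2 hxc
    have h := hf.three_point_nnreal hx hc h1 h2
    have h3 := hm x hx (h1.trans h2).ne
    have h1' : (x : ℝ) < x' := by exact_mod_cast h1
    have h2' : (x' : ℝ) < c := by exact_mod_cast h2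
    refine ⟨h.1, ?_⟩
    nlinarith [h.2, mul_lt_mul_of_pos_left h3 (sub_pos.2 h1')]
  · have h1 : c < x' := lt_of_le_of_ne h1 hxc.symm
    have h2 : x' < x := lt_of_le_of_ne h2 hne
    have h := hf.three_point_nnreal hc hx h1 h2
    have h3 := hm x hx (h1.trans h2).ne'
    have h1' : (c : ℝ) < x' := by exact_mod_cast h1
    have h2' : (x' : ℝ) < x := by exact_mod_cast h2
    refine ⟨h.1, ?_⟩
    nlinarith [h.2, mul_lt_mul_of_pos_left h3 (sub_pos.2 h2')]

/-- The extended-real form of a supporting line, from its form on the effective domain. -/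
lemma affine_le_of_forall_effDomain {θ : ℝ≥0 → EReal} (hθ : IsProperFun θ) {a m : ℝ}
    (h : ∀ x ∈ effDomain θ, a + m * (x : ℝ) ≤ (θ x).toReal) (x : ℝ≥0) :
    ((a + m * (x : ℝ) : ℝ) : EReal) ≤ θ x := by
  by_cases hx : θ x = ⊤
  · rw [hx]; exact le_top
  · rw [← EReal.coe_toReal hx (hθ.1 x)]
    exact_mod_cast h x hx

/-- A proper strictly convex function has an affine minorant.  The slope is obtained at the
midpoint of two domain points; if the domain is a single point, any slope does. -/
lemma exists_affine_minorant {θ : ℝ≥0 → EReal} (hθ : IsProperFun θ)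
    (hf : StrictConvexOn ℝ≥0 (effDomain θ) (fun t => (θ t).toReal)) :
    ∃ a m : ℝ, ∀ x : ℝ≥0, ((a + m * (x : ℝ) : ℝ) : EReal) ≤ θ x := by
  obtain ⟨x₀, hx₀⟩ := hθ.2
  by_cases hs : ∃ z ∈ effDomain θ, z ≠ x₀
  · obtain ⟨z, hz, hne⟩ := hs
    have main : ∀ x z : ℝ≥0, x ∈ effDomain θ → z ∈ effDomain θ → x < z →
        ∃ a m : ℝ, ∀ x : ℝ≥0, ((a + m * (x : ℝ) : ℝ) : EReal) ≤ θ x := by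
      intro x z hx hz hxz
      obtain ⟨c, h1, h2⟩ := exists_between hxz
      obtain ⟨m, hm⟩ := hf.exists_strict_support hx hz h1 h2
      refine ⟨(θ c).toReal - m * c, m, affine_le_of_forall_effDomain hθ fun y hy => ?_⟩
      rcases eq_or_ne y c with rfl | hyc
      · simp
      · have := hm y hy hyc
        linarith
    rcases lt_or_gt_of_ne hne with h | h
    · exact main _ _ hz hx₀ h
    · exact main _ _ hx₀ hz h
  · push Not at hs
    refine ⟨(θ x₀).toReal, 0, affine_le_of_forall_effDomain hθ fun y hy => ?_⟩
    rw [hs y hy]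
    simp

lemma le_recessionSlope_of_affine_le {θ : ℝ≥0 → EReal} {a m : ℝ}
    (h : ∀ x : ℝ≥0, ((a + m * (x : ℝ) : ℝ) : EReal) ≤ θ x) :
    (m : EReal) ≤ recessionSlope θ := by
  have ht : Tendsto (fun t : ℝ≥0 => (t : ℝ)) atTop atTop := NNReal.tendsto_coe_atTop.2 tendsto_id
  have hlim : Tendsto (fun t : ℝ≥0 => ((a / (t : ℝ) + m : ℝ) : EReal)) atTop (nhds (m : EReal)) := by
    have : Tendsto (fun t : ℝ≥0 => a / (t : ℝ) + m) atTop (nhds (0 + m)) :=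
      (tendsto_const_nhds.div_atTop ht).add tendsto_const_nhds
    rw [zero_add] at this
    exact (continuous_coe_real_ereal.tendsto m).comp this
  rw [← hlim.limsup_eq]
  refine limsup_le_limsup ?_
  filter_upwards [eventually_gt_atTop 0] with t ht0
  have ht0' : (0 : ℝ) < t := by exact_mod_cast ht0
  have h1 : ((a / (t : ℝ) + m : ℝ) : EReal) = ((a + m * (t : ℝ) : ℝ) : EReal) / ((t : ℝ) : EReal) := by
    rw [← EReal.coe_div]
    congr 1
    field_simp
  rw [h1]
  exact EReal.div_le_div_right_of_nonneg (by exact_mod_cast ht0'.le) (h t)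

lemma recessionSlope_eq_top {θ : ℝ≥0 → EReal} {t₀ : ℝ≥0} (h : ∀ t, t₀ ≤ t → θ t = ⊤) :
    recessionSlope θ = ⊤ := by
  have : (fun t : ℝ≥0 => θ t / ((t : ℝ) : EReal)) =ᶠ[atTop] fun _ => ⊤ := by
    filter_upwards [eventually_gt_atTop 0, eventually_ge_atTop t₀] with t ht ht'
    rw [h t ht']
    exact EReal.top_div_of_pos_ne_top (by exact_mod_cast ht) (EReal.coe_ne_top _)
  rw [recessionSlope, limsup_congr this, limsup_const]

/-! ### The divergence as an integral of real-valued functions -/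

section Divergence

variable {Y : Type*} [MeasurableSpace Y]

lemma extIntegral_eq_coe_integral {μ : Measure Y} {F : Y → EReal} {g : Y → ℝ}
    (hF : ∀ᵐ y ∂μ, F y = (g y : EReal)) (hg : Integrable g μ) :
    extIntegral F μ = ((∫ y, g y ∂μ : ℝ) : EReal) := by
  have h1 : ∫⁻ y, (F y).toENNReal ∂μ = ∫⁻ y, ENNReal.ofReal (g y) ∂μ :=
    lintegral_congr_ae (hF.mono fun y hy => by simp [hy, EReal.toENNReal_of_ne_top])
  have h2 : ∫⁻ y, (-F y).toENNReal ∂μ = ∫⁻ y, ENNReal.ofReal (-g y) ∂μ :=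
    lintegral_congr_ae (hF.mono fun y hy => by
      simp only [hy, ← EReal.coe_neg]
      rw [EReal.toENNReal_of_ne_top (EReal.coe_ne_top _), EReal.toReal_coe])
  rw [extIntegral, h1, h2, integral_eq_lintegral_pos_part_sub_lintegral_neg_part hg,
    EReal.coe_sub, EReal.coe_ennreal_toReal hg.lintegral_lt_top.ne,
    EReal.coe_ennreal_toReal (x := ∫⁻ y, ENNReal.ofReal (-g y) ∂μ) hg.neg.lintegral_lt_top.ne]

/-- What finiteness of the divergence of a function with an affine minorant gives: the density lies
in the effective domain, `θ` of the density is integrable, and an infinite recession slope forces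
absolute continuity. -/
lemma thetaDivergence_lt_top_consequences {θ : ℝ≥0 → EReal} {a m : ℝ} (hmeas : Measurable θ)
    (h : ∀ x : ℝ≥0, ((a + m * (x : ℝ) : ℝ) : EReal) ≤ θ x) {P ν : Measure Y}
    [IsFiniteMeasure P] [IsFiniteMeasure ν] (hfin : thetaDivergence θ P ν < ⊤) :
    (∀ᵐ y ∂ν, (P.rnDeriv ν y).toNNReal ∈ effDomain θ) ∧
    Integrable (fun y => (θ (P.rnDeriv ν y).toNNReal).toReal) ν ∧
    (recessionSlope θ = ⊤ → P.singularPart ν Set.univ = 0) := by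
  set r : Y → ℝ≥0 := fun y => (P.rnDeriv ν y).toNNReal with hr
  have hrm : Measurable r := (P.measurable_rnDeriv ν).ennreal_toNNReal
  have hri : Integrable (fun y => (r y : ℝ)) ν := Measure.integrable_toReal_rnDeriv
  have hlow : Integrable (fun y => a + m * (r y : ℝ)) ν :=
    (integrable_const a).add (hri.const_mul m)
  have hneg : ∫⁻ y, (-θ (r y)).toENNReal ∂ν < ⊤ := by
    refine lt_of_le_of_lt (lintegral_mono fun y => ?_) hlow.neg.lintegral_lt_top
    have h1 : -θ (r y) ≤ ((-(a + m * (r y : ℝ)) : ℝ) : EReal) := by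
      rw [EReal.coe_neg]
      exact EReal.neg_le_neg_iff.2 (h (r y))
    refine (EReal.toENNReal_le_toENNReal h1).trans ?_
    rw [EReal.toENNReal_of_ne_top (EReal.coe_ne_top _), EReal.toReal_coe]
    rfl
  have hslope := le_recessionSlope_of_affine_le h
  set S : ℝ≥0∞ := P.singularPart ν Set.univ with hS
  have hSfin : S ≠ ⊤ := measure_ne_top _ _
  have hextbot : extIntegral (fun y => θ (r y)) ν ≠ ⊥ := by
    rw [extIntegral, sub_eq_add_neg]
    rw [Ne, EReal.add_eq_bot_iff]
    push Not
    refine ⟨EReal.coe_ennreal_ne_bot _, fun h' => ?_⟩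
    rw [EReal.neg_eq_bot_iff, EReal.coe_ennreal_eq_top_iff] at h'
    exact hneg.ne h'
  have hmulbot : recessionSlope θ * (S : EReal) ≠ ⊥ := by
    induction hs : recessionSlope θ using EReal.rec with
    | bot => rw [hs] at hslope; exact absurd (le_bot_iff.1 hslope) (EReal.coe_ne_bot _)
    | coe k =>
      rw [← EReal.coe_ennreal_toReal hSfin, ← EReal.coe_mul]
      exact EReal.coe_ne_bot _
    | top =>
      exact ne_of_gt (lt_of_lt_of_le EReal.bot_lt_zero (mul_nonneg le_top (EReal.coe_ennreal_nonneg _)))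
  have hfin' : extIntegral (fun y => θ (r y)) ν + recessionSlope θ * (S : EReal) < ⊤ := hfin
  have hpos : ∫⁻ y, (θ (r y)).toENNReal ∂ν < ⊤ := by
    by_contra hcon
    rw [not_lt, top_le_iff] at hcon
    have : extIntegral (fun y => θ (r y)) ν = ⊤ := by
      rw [extIntegral, hcon, EReal.coe_ennreal_top]
      exact EReal.top_sub (by rw [Ne, EReal.coe_ennreal_eq_top_iff]; exact hneg.ne)
    rw [this, EReal.top_add_of_ne_bot hmulbot] at hfin'
    exact lt_irrefl _ hfin'
  have hθr : Measurable fun y => θ (r y) := hmeas.comp hrm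
  refine ⟨?_, ?_, fun hs => ?_⟩
  · filter_upwards [ae_lt_top hθr.ereal_toENNReal hpos.ne] with y hy hcon
    rw [hcon] at hy
    simp at hy
  · refine ⟨hθr.ereal_toReal.aestronglyMeasurable, ?_⟩
    refine lt_of_le_of_lt (lintegral_mono (g := fun y => (θ (r y)).toENNReal + (-θ (r y)).toENNReal)
      fun y => ?_) ?_
    · change ‖(θ (r y)).toReal‖ₑ ≤ (θ (r y)).toENNReal + (-θ (r y)).toENNReal
      induction hx : θ (r y) using EReal.rec with
      | bot => simp
      | top => simp
      | coe x =>
        rw [← EReal.coe_neg, EReal.toENNReal_of_ne_top (EReal.coe_ne_top _),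
          EReal.toENNReal_of_ne_top (EReal.coe_ne_top _), EReal.toReal_coe, EReal.toReal_coe,
          Real.enorm_eq_ofReal_abs]
        rcases le_total 0 x with h0 | h0
        · rw [abs_of_nonneg h0]; exact le_self_add
        · rw [abs_of_nonpos h0]; exact le_add_self
    · rw [lintegral_add_left hθr.ereal_toENNReal]
      exact ENNReal.add_lt_top.2 ⟨hpos, hneg⟩
  · by_contra hcon
    rw [hs, EReal.top_mul_of_pos (by rw [EReal.coe_ennreal_pos]; exact pos_iff_ne_zero.2 hcon),
      EReal.add_top_of_ne_bot hextbot] at hfin'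
    exact lt_irrefl _ hfin'

lemma measureReal_univ_eq_integral_rnDeriv_add (P ν : Measure Y) [IsFiniteMeasure P]
    [IsFiniteMeasure ν] :
    (P Set.univ).toReal = ∫ y, ((P.rnDeriv ν y).toNNReal : ℝ) ∂ν
      + (P.singularPart ν Set.univ).toReal := by
  have h1 : ∫ y, ((P.rnDeriv ν y).toNNReal : ℝ) ∂ν = (∫⁻ y, P.rnDeriv ν y ∂ν).toReal :=
    integral_toReal (P.measurable_rnDeriv ν).aemeasurable (P.rnDeriv_lt_top ν)
  rw [h1, ← ENNReal.toReal_add (Measure.lintegral_rnDeriv_lt_top P ν).ne (measure_ne_top _ _)]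
  conv_lhs => rw [← Measure.singularPart_add_rnDeriv P ν]
  rw [Measure.add_apply, withDensity_apply _ MeasurableSet.univ, Measure.restrict_univ, add_comm]

/-- If mass is moved so that the density comes nearer, pointwise, to a level `c` interior to the
effective domain and the singular part does not grow, then the divergence strictly decreases. -/
theorem thetaDivergence_lt_of_between {θ : ℝ≥0 → EReal} (hθ : IsProperFun θ)
    (hmeas : Measurable θ) (hf : StrictConvexOn ℝ≥0 (effDomain θ) (fun t => (θ t).toReal))
    {P P' ν : Measure Y} [IsFiniteMeasure P] [IsFiniteMeasure P'] [IsFiniteMeasure ν]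
    {x₀ c z₀ : ℝ≥0} (hx₀ : x₀ ∈ effDomain θ) (hz₀ : z₀ ∈ effDomain θ) (h₁ : x₀ < c) (h₂ : c < z₀)
    (hfin : thetaDivergence θ P ν < ⊤) (hmass : P' Set.univ = P Set.univ)
    (hsing : P'.singularPart ν Set.univ ≤ P.singularPart ν Set.univ)
    (hbet : ∀ᵐ y ∂ν, ((P.rnDeriv ν y).toNNReal ≤ (P'.rnDeriv ν y).toNNReal ∧
        (P'.rnDeriv ν y).toNNReal ≤ c) ∨
      (c ≤ (P'.rnDeriv ν y).toNNReal ∧ (P'.rnDeriv ν y).toNNReal ≤ (P.rnDeriv ν y).toNNReal))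
    (hne : ¬ ∀ᵐ y ∂ν, (P'.rnDeriv ν y).toNNReal = (P.rnDeriv ν y).toNNReal) :
    thetaDivergence θ P' ν < thetaDivergence θ P ν := by
  obtain ⟨m, hm⟩ := hf.exists_strict_support hx₀ hz₀ h₁ h₂
  have hcD : c ∈ effDomain θ := (hf.three_point_nnreal hx₀ hz₀ h₁ h₂).1
  have hminor : ∀ x : ℝ≥0, (((θ c).toReal - m * c + m * (x : ℝ) : ℝ) : EReal) ≤ θ x :=
    affine_le_of_forall_effDomain hθ fun y hy => by
      rcases eq_or_ne y c with rfl | hyc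
      · simp
      · have := hm y hy hyc
        linarith
  obtain ⟨hdom, hint, hS0⟩ := thetaDivergence_lt_top_consequences hmeas hminor hfin
  have hmslope := le_recessionSlope_of_affine_le hminor
  have hmP := measureReal_univ_eq_integral_rnDeriv_add P ν
  have hmP' := measureReal_univ_eq_integral_rnDeriv_add P' ν
  have hri : Integrable (fun y => ((P.rnDeriv ν y).toNNReal : ℝ)) ν :=
    Measure.integrable_toReal_rnDeriv
  have hri' : Integrable (fun y => ((P'.rnDeriv ν y).toNNReal : ℝ)) ν :=
    Measure.integrable_toReal_rnDeriv
  have hrm' : Measurable fun y => (P'.rnDeriv ν y).toNNReal :=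
    (P'.measurable_rnDeriv ν).ennreal_toNNReal
  unfold thetaDivergence
  set r : Y → ℝ≥0 := fun y => (P.rnDeriv ν y).toNNReal
  set r' : Y → ℝ≥0 := fun y => (P'.rnDeriv ν y).toNNReal
  set f : ℝ≥0 → ℝ := fun t => (θ t).toReal with hfdef
  change _ = ∫ y, (r y : ℝ) ∂ν + _ at hmP
  change _ = ∫ y, (r' y : ℝ) ∂ν + _ at hmP'
  set U : Y → ℝ := fun y => f (r y) + m * ((r' y : ℝ) - r y) with hU
  have hUi : Integrable U ν := hint.add ((hri'.sub hri).const_mul m)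
  have hle : ∀ᵐ y ∂ν, r' y ∈ effDomain θ ∧ f (r' y) ≤ U y := by
    filter_upwards [hdom, hbet] with y hy hb
    rcases eq_or_ne (r' y) (r y) with he | hne
    · simp only [hU, he]
      exact ⟨hy, by simp⟩
    · have := hf.lt_of_between hcD hm hy hne hb
      exact ⟨this.1, this.2.le⟩
  have hint' : Integrable (fun y => f (r' y)) ν := by
    refine integrable_of_le_of_le (hmeas.comp hrm').ereal_toReal.aestronglyMeasurable
      (g₁ := fun y => f c - m * c + m * (r' y : ℝ)) (g₂ := U) ?_ ?_
      ((integrable_const _).add (hri'.const_mul m)) hUi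
    · filter_upwards [hle] with y hy
      have := hminor (r' y)
      rw [← EReal.coe_toReal hy.1 (hθ.1 _)] at this
      exact_mod_cast this
    · exact hle.mono fun y hy => hy.2
  have hltU : ∫ y, f (r' y) ∂ν < ∫ y, U y ∂ν := by
    refine lt_of_le_of_ne (integral_mono_ae hint' hUi (hle.mono fun y hy => hy.2)) fun heq => hne ?_
    rw [integral_eq_iff_of_ae_le hint' hUi (hle.mono fun y hy => hy.2)] at heq
    filter_upwards [hdom, hbet, heq] with y hy hb he
    by_contra hcon
    exact (hf.lt_of_between hcD hm hy hcon hb).2.ne he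
  have hUval : ∫ y, U y ∂ν = ∫ y, f (r y) ∂ν
      + m * (∫ y, (r' y : ℝ) ∂ν - ∫ y, (r y : ℝ) ∂ν) := by
    have h1 := integral_add hint ((hri'.sub hri).const_mul m)
    rw [integral_const_mul] at h1
    exact h1.trans (congrArg (fun z => _ + m * z) (integral_sub hri' hri))
  have hE : extIntegral (fun y => θ (r y)) ν = ((∫ y, f (r y) ∂ν : ℝ) : EReal) :=
    extIntegral_eq_coe_integral (hdom.mono fun y hy => (EReal.coe_toReal hy (hθ.1 _)).symm) hint
  have hE' : extIntegral (fun y => θ (r' y)) ν = ((∫ y, f (r' y) ∂ν : ℝ) : EReal) :=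
    extIntegral_eq_coe_integral (hle.mono fun y hy => (EReal.coe_toReal hy.1 (hθ.1 _)).symm) hint'
  rw [hE, hE']
  have hSfin : P.singularPart ν Set.univ ≠ ⊤ := measure_ne_top _ _
  have hSfin' : P'.singularPart ν Set.univ ≠ ⊤ := measure_ne_top _ _
  rw [hmass] at hmP'
  have hsr : (P'.singularPart ν Set.univ).toReal ≤ (P.singularPart ν Set.univ).toReal :=
    ENNReal.toReal_mono hSfin hsing
  induction hs : recessionSlope θ using EReal.rec with
  | bot => rw [hs] at hmslope; exact absurd (le_bot_iff.1 hmslope) (EReal.coe_ne_bot _)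
  | coe k =>
    rw [hs] at hmslope
    have hmk : m ≤ k := by exact_mod_cast hmslope
    rw [← EReal.coe_ennreal_toReal hSfin, ← EReal.coe_ennreal_toReal hSfin', ← EReal.coe_mul,
      ← EReal.coe_mul, ← EReal.coe_add, ← EReal.coe_add, EReal.coe_lt_coe_iff]
    have hdiff : ∫ y, (r' y : ℝ) ∂ν - ∫ y, (r y : ℝ) ∂ν =
        (P.singularPart ν Set.univ).toReal - (P'.singularPart ν Set.univ).toReal := by linarith
    rw [hdiff] at hUval
    nlinarith [mul_nonneg (sub_nonneg.2 hmk) (sub_nonneg.2 hsr)]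
  | top =>
    have h0 := hS0 hs
    have h0' : P'.singularPart ν Set.univ = 0 := le_antisymm (hsing.trans h0.le) bot_le
    rw [h0, ENNReal.toReal_zero] at hmP
    rw [h0', ENNReal.toReal_zero] at hmP'
    simp only [h0, h0', EReal.coe_ennreal_zero, mul_zero, add_zero, EReal.coe_lt_coe_iff]
    have : ∫ y, (r' y : ℝ) ∂ν = ∫ y, (r y : ℝ) ∂ν := by linarith
    rw [this] at hUval
    linarith

end Divergence

/-! ### Densities of marginals -/

section Densities

variable {Z Y : Type*} [MeasurableSpace Z] [MeasurableSpace Y]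

lemma map_withDensity_comp {κ : Measure Z} {p : Z → Y} (hp : Measurable p) {g : Y → ℝ≥0∞}
    (hg : Measurable g) : (κ.withDensity fun z => g (p z)).map p = (κ.map p).withDensity g := by
  ext s hs
  rw [Measure.map_apply hp hs, withDensity_apply _ (hp hs), withDensity_apply _ hs,
    setLIntegral_map hs hg hp]

lemma withDensity_le_self {κ : Measure Z} {f : Z → ℝ≥0∞} (hf : ∀ z, f z ≤ 1) :
    κ.withDensity f ≤ κ := by
  calc κ.withDensity f ≤ κ.withDensity 1 := withDensity_mono (Eventually.of_forall hf)
    _ = κ := withDensity_one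

lemma rnDeriv_le_rnDeriv_of_le {ρ ρ' ν : Measure Y} [IsFiniteMeasure ρ'] [IsFiniteMeasure ν]
    (h : ρ ≤ ρ') : ρ.rnDeriv ν ≤ᵐ[ν] ρ'.rnDeriv ν := by
  have : IsFiniteMeasure ρ := isFiniteMeasure_of_le ρ' h
  have : IsFiniteMeasure (ρ' - ρ) := isFiniteMeasure_of_le ρ' Measure.sub_le
  have h1 := Measure.rnDeriv_add (ρ' - ρ) ρ ν
  rw [Measure.sub_add_cancel_of_le h] at h1
  filter_upwards [h1] with y hy
  rw [hy]
  exact le_add_self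

lemma rnDeriv_le_of_le_smul {ρ ν : Measure Y} [IsFiniteMeasure ν] {t : ℝ≥0} (h : ρ ≤ t • ν) :
    ∀ᵐ y ∂ν, ρ.rnDeriv ν y ≤ t := by
  filter_upwards [rnDeriv_le_rnDeriv_of_le (ν := ν) h, Measure.rnDeriv_smul_left' ν ν t,
    Measure.rnDeriv_self ν] with y h1 h2 h3
  rw [h2, Pi.smul_apply, h3] at h1
  simpa [ENNReal.smul_def] using h1

lemma rnDeriv_eq_zero_of_measure_eq_zero {ρ ν : Measure Y} {s : Set Y} (hs : MeasurableSet s)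
    (h : ρ s = 0) : ∀ᵐ y ∂ν, y ∈ s → ρ.rnDeriv ν y = 0 := by
  rw [← ae_restrict_iff' hs]
  have h1 : ∫⁻ y in s, ρ.rnDeriv ν y ∂ν = 0 :=
    le_antisymm ((Measure.setLIntegral_rnDeriv_le s).trans h.le) bot_le
  exact (lintegral_eq_zero_iff (ρ.measurable_rnDeriv ν)).1 h1

/-- A measurable set carrying the singular part of `P` and null for `ν`. -/
lemma exists_singular_carrier (P ν : Measure Y) :
    ∃ S : Set Y, MeasurableSet S ∧ ν S = 0 ∧ P.singularPart ν Sᶜ = 0 := by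
  obtain ⟨s, hs, h1, h2⟩ := P.mutuallySingular_singularPart ν
  exact ⟨sᶜ, hs.compl, h2, by rwa [compl_compl]⟩

lemma measure_eq_singularPart_add_setLIntegral (P ν : Measure Y) [IsFiniteMeasure P]
    [IsFiniteMeasure ν] {s : Set Y} (hs : MeasurableSet s) :
    P s = P.singularPart ν s + ∫⁻ y in s, P.rnDeriv ν y ∂ν := by
  conv_lhs => rw [← Measure.singularPart_add_rnDeriv P ν]
  rw [Measure.add_apply, withDensity_apply _ hs]

end Densities

/-! ### The exchange argument

The two coordinate projections enter only as measurable maps `p : Z → X` and `q : Z → Y` on the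
space `Z` of pairs, which treats both sides at once. -/

section Exchange

variable {Z X Y : Type*} [MeasurableSpace Z] [MeasurableSpace X] [MeasurableSpace Y]

/-- The finite measures carried by `E` whose image under `p` is `μ`. -/
def liftsAlong (E : Set Z) (p : Z → X) (μ : Measure X) : Set (Measure Z) :=
  {π | IsFiniteMeasure π ∧ π Eᶜ = 0 ∧ π.map p = μ}

/-- A small transfer: replacing the part `G` of `π` by `τ` at rate `ε`.  If `τ` has the same
`p`-marginal as `π.withDensity G`, the result has the same `p`-marginal as `π`. -/
lemma transfer_mem_liftsAlong {E : Set Z} {p : Z → X} (hp : Measurable p)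
    {μ : Measure X} {π τ : Measure Z} (hπ : π ∈ liftsAlong E p μ) [IsFiniteMeasure τ]
    (hτE : τ Eᶜ = 0) {G : Z → ℝ≥0∞} (hG : Measurable G) (hG1 : ∀ z, G z ≤ 1)
    (hτ : τ.map p = (π.withDensity G).map p) {ε : ℝ≥0} (hε : ε ≤ 1) :
    π.withDensity (fun z => 1 - ε * G z) + ε • π.withDensity G = π ∧
    π.withDensity (fun z => 1 - ε * G z) + ε • τ ∈ liftsAlong E p μ := by
  obtain ⟨hfin, hE, hmap⟩ := hπ
  have hεG : ∀ z, (ε : ℝ≥0∞) * G z ≤ 1 := fun z =>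
    mul_le_one' (by exact_mod_cast hε) (hG1 z)
  have hsum : π.withDensity (fun z => 1 - ε * G z) + ε • π.withDensity G = π := by
    have h1 : ε • π.withDensity G = π.withDensity ((ε : ℝ≥0∞) • G) := by
      rw [withDensity_smul _ hG]; rfl
    rw [h1, ← withDensity_add_right _ (hG.const_smul (ε : ℝ≥0∞))]
    have : ((fun z => 1 - ε * G z) + (ε : ℝ≥0∞) • G) = 1 := by
      funext z
      simp only [Pi.add_apply, Pi.smul_apply, smul_eq_mul, Pi.one_apply]
      exact tsub_add_cancel_of_le (hεG z)
    rw [this, withDensity_one]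
  have hκ : π.withDensity (fun z => 1 - ε * G z) ≤ π := withDensity_le_self fun z => tsub_le_self
  have : IsFiniteMeasure (π.withDensity (fun z => 1 - ε * G z)) := isFiniteMeasure_of_le π hκ
  refine ⟨hsum, inferInstance, ?_, ?_⟩
  · rw [Measure.add_apply, Measure.smul_apply, hτE, smul_zero, add_zero]
    exact le_antisymm ((hκ _).trans hE.le) bot_le
  · rw [Measure.map_add _ _ hp, Measure.map_smul, hτ, ← Measure.map_smul, ← Measure.map_add _ _ hp,
      hsum, hmap]

variable {E : Set Z} {p : Z → X} {q : Z → Y}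
  {μ : Measure X} {ν : Measure Y} [IsFiniteMeasure ν] {π : Measure Z} {θ : ℝ≥0 → EReal}

/-- A minimizer of the divergence admits no transfer from the region where its density is at least
`b`, singular part included, to the region where its density is at most `a < b`.  A transfer at
small rate would bring the density closer to the level `(a + b) / 2`.  When that level is not
interior to the effective domain of `θ`, one of the two regions is already negligible. -/
theorem eq_zero_of_transfer_of_minimizer (hp : Measurable p) (hq : Measurable q)
    (hθ : IsProperFun θ) (hmeas : Measurable θ)
    (hf : StrictConvexOn ℝ≥0 (effDomain θ) (fun t => (θ t).toReal))
    (hπ : π ∈ liftsAlong E p μ)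
    (hmin : ∀ π' ∈ liftsAlong E p μ,
      thetaDivergence θ (π.map q) ν ≤ thetaDivergence θ (π'.map q) ν)
    (hfin : thetaDivergence θ (π.map q) ν < ⊤)
    {S : Set Y} (hS : MeasurableSet S) (hνS : ν S = 0)
    {a b t : ℝ≥0} (hab : a < b) {τ : Measure Z} (hτE : τ Eᶜ = 0)
    (hτp : τ.map p ≤ (π.restrict (q ⁻¹' ({y | (b : ℝ≥0∞) ≤ (π.map q).rnDeriv ν y} ∪ S))).map p)
    (hτq : τ.map q ≤ t • ν) (hτa : τ (q ⁻¹' {y | (π.map q).rnDeriv ν y ≤ a})ᶜ = 0) :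
    τ = 0 := by
  have hπfin : IsFiniteMeasure π := hπ.1
  set P := π.map q with hPdef
  have hPfin : IsFiniteMeasure P := Measure.isFiniteMeasure_map π q
  have hrm : Measurable (P.rnDeriv ν) := P.measurable_rnDeriv ν
  set B : Set Y := {y | (b : ℝ≥0∞) ≤ P.rnDeriv ν y} ∪ S with hB
  have hBm : MeasurableSet B := (measurableSet_le measurable_const hrm).union hS
  set A : Set Y := {y | P.rnDeriv ν y ≤ a} with hA
  have hAm : MeasurableSet A := measurableSet_le hrm measurable_const
  have hlt : ∀ᵐ y ∂ν, P.rnDeriv ν y < ⊤ := P.rnDeriv_lt_top ν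
  have hSae : ∀ᵐ y ∂ν, y ∉ S := by
    rw [ae_iff]; simpa using hνS
  obtain ⟨a₀, m₀, hminor⟩ := exists_affine_minorant hθ hf
  obtain ⟨hdom, -, hsing⟩ := thetaDivergence_lt_top_consequences hmeas hminor hfin
  set lam := (π.restrict (q ⁻¹' B)).map p with hlam
  have hlamfin : IsFiniteMeasure lam := Measure.isFiniteMeasure_map _ p
  have hτpfin : IsFiniteMeasure (τ.map p) := isFiniteMeasure_of_le lam hτp
  have huniv : ∀ κ : Measure Z, κ.map p Set.univ = κ Set.univ := fun κ => by
    rw [Measure.map_apply hp MeasurableSet.univ, Set.preimage_univ]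
  have hτfin : IsFiniteMeasure τ := ⟨by rw [← huniv]; exact measure_lt_top _ _⟩
  obtain ⟨c, hac⟩ : ∃ c : ℝ≥0, (c : ℝ) = ((a : ℝ) + b) / 2 := ⟨(a + b) / 2, by simp⟩
  have hab' : (a : ℝ) < b := by exact_mod_cast hab
  have hac' : a < c := by rw [← NNReal.coe_lt_coe, hac]; linarith
  have hcb' : c < b := by rw [← NNReal.coe_lt_coe, hac]; linarith
  by_cases hlo : ∃ x₀ ∈ effDomain θ, x₀ < c
  swap
  · push Not at hlo
    have hνA : ν A = 0 := by
      have h1 : ∀ᵐ y ∂ν, y ∉ A := by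
        filter_upwards [hdom] with y hy hyA
        have h2 := hlo _ hy
        have h3 : (P.rnDeriv ν y).toNNReal ≤ a := by
          have := ENNReal.toNNReal_mono ENNReal.coe_ne_top hyA
          simpa using this
        exact absurd (h2.trans h3) (not_le.2 hac')
      rw [ae_iff] at h1
      simpa using h1
    have h1 : τ (q ⁻¹' A) = 0 := by
      rw [← Measure.map_apply hq hAm]
      refine le_antisymm ((hτq A).trans ?_) bot_le
      rw [Measure.smul_apply, hνA, smul_zero]
    rw [← Measure.measure_univ_eq_zero, ← Set.union_compl_self (q ⁻¹' A)]
    exact measure_union_null h1 hτa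
  by_cases hhi : ∃ z₀ ∈ effDomain θ, c < z₀
  swap
  · push Not at hhi
    have hslope : recessionSlope θ = ⊤ := recessionSlope_eq_top (t₀ := b) fun s hs => by
      by_contra hcon
      exact absurd (hhi s hcon) (not_le.2 (hcb'.trans_le hs))
    have hPB : P B = 0 := by
      have hνB : ν B = 0 := by
        refine measure_union_null ?_ hνS
        have h1 : ∀ᵐ y ∂ν, ¬ (b : ℝ≥0∞) ≤ P.rnDeriv ν y := by
          filter_upwards [hdom, hlt] with y hy hylt hby
          have h2 := hhi _ hy
          have h3 : b ≤ (P.rnDeriv ν y).toNNReal := by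
            have := ENNReal.toNNReal_mono hylt.ne hby
            simpa using this
          exact absurd (h3.trans h2) (not_le.2 hcb')
        rw [ae_iff] at h1
        simpa using h1
      rw [measure_eq_singularPart_add_setLIntegral P ν hBm, setLIntegral_measure_zero _ _ hνB,
        add_zero]
      exact le_antisymm ((measure_mono (Set.subset_univ _)).trans (hsing hslope).le) bot_le
    have hlam0 : lam = 0 := by
      rw [hlam, Measure.restrict_eq_zero.2 (by rwa [← Measure.map_apply hq hBm]), Measure.map_zero]
    rw [← Measure.measure_univ_eq_zero, ← huniv]
    exact le_antisymm ((hτp _).trans (by rw [hlam0]; simp)) bot_le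
  obtain ⟨x₀, hx₀, hx₀c⟩ := hlo
  obtain ⟨z₀, hz₀, hcz₀⟩ := hhi
  -- `G` selects a part of `π` over `B` with the same `p`-marginal as `τ`.
  have hac_τ : τ.map p ≪ lam := Measure.absolutelyContinuous_of_le hτp
  set g : X → ℝ≥0∞ := fun x => min ((τ.map p).rnDeriv lam x) 1 with hg
  have hgm : Measurable g := ((τ.map p).measurable_rnDeriv lam).min measurable_const
  have hlamg : lam.withDensity g = τ.map p := by
    conv_rhs => rw [← Measure.withDensity_rnDeriv_eq _ _ hac_τ]
    refine withDensity_congr_ae ?_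
    filter_upwards [Measure.rnDeriv_le_one_of_le hτp] with x hx
    exact min_eq_left hx
  set G : Z → ℝ≥0∞ := (q ⁻¹' B).indicator fun z => g (p z) with hG
  have hGm : Measurable G := (hgm.comp hp).indicator (hq hBm)
  have hG1 : ∀ z, G z ≤ 1 := fun z => by
    rw [hG]
    refine (Set.indicator_le_self' (fun _ _ => zero_le) z).trans (min_le_right _ _)
  have hGmap : τ.map p = (π.withDensity G).map p := by
    rw [hG, withDensity_indicator (hq hBm), map_withDensity_comp hp hgm, ← hlamg]
  -- The rate is small enough for the density not to cross the level `c`.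
  obtain ⟨ε, hε0, hε1, hεt, hεb⟩ : ∃ ε : ℝ≥0, 0 < ε ∧ ε ≤ 1 ∧ (a : ℝ) + ε * t ≤ c ∧
      (c : ℝ) ≤ (1 - ε) * b := by
    have ht0 : (0 : ℝ) ≤ t := t.2
    have ha0 : (0 : ℝ) ≤ a := a.2
    have hden : (0 : ℝ) < 2 * (t + b + 1) := by linarith
    have hpos : 0 < ((b : ℝ) - a) / (2 * (t + b + 1)) := div_pos (by linarith) hden
    have hkey : ((b : ℝ) - a) / (2 * (t + b + 1)) * (2 * (t + b + 1)) = b - a :=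
      div_mul_cancel₀ _ hden.ne'
    obtain ⟨ε, hε⟩ : ∃ ε : ℝ≥0, (ε : ℝ) = ((b : ℝ) - a) / (2 * (t + b + 1)) :=
      ⟨Real.toNNReal _, Real.coe_toNNReal _ hpos.le⟩
    rw [← hε] at hpos hkey
    refine ⟨ε, by exact_mod_cast hpos, ?_, ?_, ?_⟩
    · rw [← NNReal.coe_le_coe, hε, NNReal.coe_one, div_le_one hden]
      linarith
    · nlinarith
    · nlinarith
  obtain ⟨hsum, hπ'⟩ := transfer_mem_liftsAlong hp hπ hτE hGm hG1 hGmap hε1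
  set κ₀ := π.withDensity (fun z => 1 - ε * G z) with hκ₀
  have hκfin : IsFiniteMeasure κ₀ := isFiniteMeasure_of_le π (by
    rw [hκ₀]; exact withDensity_le_self fun z => tsub_le_self)
  have hηle : π.withDensity G ≤ π := withDensity_le_self hG1
  have hηfin : IsFiniteMeasure (π.withDensity G) := isFiniteMeasure_of_le π hηle
  set κ := κ₀.map q with hκ
  set η := (π.withDensity G).map q with hη
  set T := τ.map q with hT
  have hP : P = κ + ε • η := by
    rw [hPdef, ← hsum, Measure.map_add _ _ hq, Measure.map_smul]
  have hP' : (κ₀ + ε • τ).map q = κ + ε • T := by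
    rw [Measure.map_add _ _ hq, Measure.map_smul]
  have hκF : IsFiniteMeasure κ := Measure.isFiniteMeasure_map _ q
  have hηF : IsFiniteMeasure η := Measure.isFiniteMeasure_map _ q
  have hTF : IsFiniteMeasure T := Measure.isFiniteMeasure_map _ q
  have hTac : T ≪ ν := (Measure.absolutelyContinuous_of_le hτq).trans
    (Measure.smul_absolutelyContinuous (c := t))
  have hηB : η Bᶜ = 0 := by
    rw [hη, Measure.map_apply hq hBm.compl, withDensity_apply _ (hq hBm.compl)]
    rw [setLIntegral_congr_fun (g := fun _ => 0) (hq hBm.compl) (fun z hz => by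
      rw [hG]; exact Set.indicator_of_notMem (s := q ⁻¹' B) (a := z) hz _)]
    simp
  have hTA : T Aᶜ = 0 := by
    rw [hT, Measure.map_apply hq hAm.compl]; exact hτa
  have hrP : P.rnDeriv ν =ᵐ[ν] κ.rnDeriv ν + (ε • η).rnDeriv ν := by
    rw [hP]; exact Measure.rnDeriv_add _ _ _
  have hrP' : (κ + ε • T).rnDeriv ν =ᵐ[ν] κ.rnDeriv ν + (ε • T).rnDeriv ν :=
    Measure.rnDeriv_add _ _ _
  have hpoint : ∀ᵐ y ∂ν, ∃ k e s : ℝ≥0, (P.rnDeriv ν y).toNNReal = k + ε * e ∧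
      ((κ + ε • T).rnDeriv ν y).toNNReal = k + ε * s ∧ T.rnDeriv ν y = s ∧
      ((e = 0 ∧ k ≤ a ∧ s ≤ t) ∨ (s = 0 ∧ b ≤ k + ε * e ∧ e ≤ k + ε * e) ∨
        (e = 0 ∧ s = 0)) := by
    filter_upwards [hrP, hrP', Measure.rnDeriv_smul_left' η ν ε, Measure.rnDeriv_smul_left' T ν ε,
      κ.rnDeriv_lt_top ν, η.rnDeriv_lt_top ν, T.rnDeriv_lt_top ν, rnDeriv_le_of_le_smul hτq,
      rnDeriv_eq_zero_of_measure_eq_zero hBm.compl hηB,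
      rnDeriv_eq_zero_of_measure_eq_zero hAm.compl hTA,
      rnDeriv_le_rnDeriv_of_le (ν := ν) (Measure.map_mono hηle hq), hSae]
      with y h1 h2 h3 h4 hk he hs h5 h6 h7 h8 h9
    lift κ.rnDeriv ν y to ℝ≥0 using hk.ne with k hk'
    lift η.rnDeriv ν y to ℝ≥0 using he.ne with e he'
    lift T.rnDeriv ν y to ℝ≥0 using hs.ne with s hs'
    have h1' : P.rnDeriv ν y = ((k + ε * e : ℝ≥0) : ℝ≥0∞) := by
      rw [h1, Pi.add_apply, h3, Pi.smul_apply, ← hk', ← he']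
      simp [ENNReal.smul_def]
    have h2' : (κ + ε • T).rnDeriv ν y = ((k + ε * s : ℝ≥0) : ℝ≥0∞) := by
      rw [h2, Pi.add_apply, h4, Pi.smul_apply, ← hk', ← hs']
      simp [ENNReal.smul_def]
    refine ⟨k, e, s, by rw [h1', ENNReal.toNNReal_coe], by rw [h2', ENNReal.toNNReal_coe], rfl, ?_⟩
    by_cases hyB : y ∈ B
    · right; left
      have hby : (b : ℝ≥0∞) ≤ P.rnDeriv ν y := hyB.resolve_right h9
      refine ⟨?_, ?_, ?_⟩
      · have : y ∈ Aᶜ := fun hyA => by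
          have h10 : (b : ℝ≥0∞) ≤ a := hby.trans hyA
          exact absurd (ENNReal.coe_le_coe.1 h10) (not_le.2 hab)
        exact_mod_cast h7 this
      · rw [h1'] at hby; exact_mod_cast hby
      · change _ ≤ P.rnDeriv ν y at h8
        rw [h1', ← hη, ← he'] at h8; exact_mod_cast h8
    · have he0 : e = 0 := by exact_mod_cast h6 hyB
      by_cases hyA : y ∈ A
      · left
        refine ⟨he0, ?_, by exact_mod_cast h5⟩
        have : P.rnDeriv ν y ≤ a := hyA
        rw [h1', he0, mul_zero, add_zero] at this
        exact_mod_cast this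
      · right; right
        exact ⟨he0, by exact_mod_cast h7 hyA⟩
  by_contra hτ0
  refine absurd (hmin _ hπ') (not_le.2 ?_)
  rw [hP']
  refine thetaDivergence_lt_of_between hθ hmeas hf hx₀ hz₀ hx₀c hcz₀ hfin ?_ ?_ ?_ ?_
  · rw [← hP', hPdef, Measure.map_apply hq MeasurableSet.univ,
      Measure.map_apply hq MeasurableSet.univ, Set.preimage_univ, ← huniv, ← huniv π, hπ'.2.2,
      hπ.2.2]
  · have h1 : P.singularPart ν = κ.singularPart ν + (ε • η).singularPart ν := by
      rw [hP, Measure.singularPart_add]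
    rw [Measure.singularPart_add, Measure.singularPart_smul,
      Measure.singularPart_eq_zero_of_ac hTac, smul_zero, add_zero, h1]
    exact le_self_add
  · filter_upwards [hpoint] with y hex
    obtain ⟨k, e, s, h1, h2, -, h3⟩ := hex
    rw [h1, h2]
    have hε1' : (ε : ℝ) ≤ 1 := by exact_mod_cast hε1
    have hε0' : (0 : ℝ) < ε := by exact_mod_cast hε0
    have hs0 : (0 : ℝ) ≤ s := s.2
    have he0 : (0 : ℝ) ≤ e := e.2
    have hk0 : (0 : ℝ) ≤ k := k.2
    simp only [← NNReal.coe_le_coe, NNReal.coe_add, NNReal.coe_mul] at h3 ⊢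
    rcases h3 with ⟨rfl, hk, hs⟩ | ⟨rfl, hb, he⟩ | ⟨rfl, rfl⟩
    · left
      have := mul_le_mul_of_nonneg_left hs hε0'.le
      have h' := mul_nonneg hε0'.le hs0
      simp only [NNReal.coe_zero, mul_zero, add_zero]
      exact ⟨by linarith, by linarith⟩
    · right
      have h' := mul_nonneg hε0'.le he0
      simp only [NNReal.coe_zero, mul_zero, add_zero]
      refine ⟨?_, by linarith⟩
      have h4 : (ε : ℝ) * e ≤ ε * (k + ε * e) := mul_le_mul_of_nonneg_left he hε0'.le
      have h5 : (1 - (ε : ℝ)) * b ≤ (1 - ε) * (k + ε * e) :=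
        mul_le_mul_of_nonneg_left hb (by linarith)
      linarith
    · rcases le_total (k : ℝ) c with h | h
      · left; simpa using h
      · right; simpa using h
  · intro hall
    apply hτ0
    have hT0 : T.rnDeriv ν =ᵐ[ν] 0 := by
      filter_upwards [hall, hpoint] with y hy hex
      obtain ⟨k, e, s, h1, h2, h3, h4⟩ := hex
      rw [h1, h2] at hy
      rw [h3]
      have hse : s = e := by
        have := add_left_cancel hy
        exact mul_left_cancel₀ hε0.ne' this
      rcases h4 with ⟨he, -, -⟩ | ⟨hs, -, -⟩ | ⟨-, hs⟩
      · rw [hse, he]; rfl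
      · rw [hs]; rfl
      · rw [hs]; rfl
    have : T = 0 := by
      rw [← Measure.withDensity_rnDeriv_eq T ν hTac, withDensity_congr_ae hT0, withDensity_zero]
    rw [← Measure.measure_univ_eq_zero, ← Set.preimage_univ (f := q),
      ← Measure.map_apply hq MeasurableSet.univ]
    change T _ = 0
    rw [this]; rfl

/-- A minimizer of the divergence packs, at each level `t`, at least as much mass as any subplan
below that level.  With `B` the region where the density is at least `t` and `H` the set of
sources from which the minimizer ships to `B`, a subplan ships nothing from `H` to the complement
of `B`, by the exchange argument.  So its mass is at most `t ν(B) + μ(Hᶜ)`, and the minimizer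
ships all of `μ` on `Hᶜ` to the region where its density is below `t`. -/
theorem measure_univ_le_lintegral_min_of_minimizer (hp : Measurable p) (hq : Measurable q)
    (hθ : IsProperFun θ) (hmeas : Measurable θ)
    (hf : StrictConvexOn ℝ≥0 (effDomain θ) (fun t => (θ t).toReal))
    (hπ : π ∈ liftsAlong E p μ)
    (hmin : ∀ π' ∈ liftsAlong E p μ,
      thetaDivergence θ (π.map q) ν ≤ thetaDivergence θ (π'.map q) ν)
    (hfin : thetaDivergence θ (π.map q) ν < ⊤) {t : ℝ≥0} {σ : Measure Z} (hσE : σ Eᶜ = 0)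
    (hσp : σ.map p ≤ μ) (hσq : σ.map q ≤ t • ν) :
    σ Set.univ ≤ ∫⁻ y, min ((π.map q).rnDeriv ν y) t ∂ν := by
  have hπfin : IsFiniteMeasure π := hπ.1
  have hμfin : IsFiniteMeasure μ := by
    rw [← hπ.2.2]; exact Measure.isFiniteMeasure_map π p
  obtain ⟨S, hS, hνS, hPS⟩ := exists_singular_carrier (π.map q) ν
  have key := fun (a : ℝ≥0) (ha : a < t) (τ : Measure Z) =>
    eq_zero_of_transfer_of_minimizer (t := t) (τ := τ) hp hq hθ hmeas hf hπ hmin hfin hS hνS ha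
  set P := π.map q with hPdef
  have hPfin : IsFiniteMeasure P := Measure.isFiniteMeasure_map π q
  have hrm : Measurable (P.rnDeriv ν) := P.measurable_rnDeriv ν
  set U : Set Y := {y | (t : ℝ≥0∞) ≤ P.rnDeriv ν y} with hU
  have hUm : MeasurableSet U := measurableSet_le measurable_const hrm
  have hBm : MeasurableSet (U ∪ S) := hUm.union hS
  set lam := (π.restrict (q ⁻¹' (U ∪ S))).map p with hlam
  have hlamle : lam ≤ μ := by
    rw [← hπ.2.2]; exact Measure.map_mono Measure.restrict_le_self hp
  have hlamfin : IsFiniteMeasure lam := isFiniteMeasure_of_le μ hlamle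
  set g := lam.rnDeriv μ with hg
  have hgm : Measurable g := lam.measurable_rnDeriv μ
  have hlamg : ∀ s, ∫⁻ x in s, g x ∂μ = lam s := fun s =>
    Measure.setLIntegral_rnDeriv (Measure.absolutelyContinuous_of_le hlamle) s
  set H : Set X := {x | g x ≠ 0} with hH
  have hHm : MeasurableSet H := (hgm (measurableSet_singleton 0)).compl
  have hnull : ∀ a : ℝ≥0, a < t → σ (p ⁻¹' H ∩ q ⁻¹' {y | P.rnDeriv ν y ≤ a}) = 0 := by
    intro a ha
    have hAm : MeasurableSet {y | P.rnDeriv ν y ≤ a} := measurableSet_le hrm measurable_const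
    set D := p ⁻¹' H ∩ q ⁻¹' {y | P.rnDeriv ν y ≤ a} with hD
    have hDm : MeasurableSet D := (hp hHm).inter (hq hAm)
    have hhm : Measurable fun z => min (g (p z)) 1 := (hgm.comp hp).min measurable_const
    set τ := (σ.restrict D).withDensity (fun z => min (g (p z)) 1) with hτ
    have hτσ : τ ≤ σ := (withDensity_le_self fun z => min_le_right _ _).trans
      Measure.restrict_le_self
    have hτ0 : τ = 0 := by
      refine key a ha τ ?_ ?_ ((Measure.map_mono hτσ hq).trans hσq) ?_
      · exact le_antisymm ((hτσ _).trans hσE.le) bot_le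
      · rw [Measure.le_iff]
        intro s hs
        calc τ.map p s = ∫⁻ z in p ⁻¹' s, min (g (p z)) 1 ∂(σ.restrict D) := by
              rw [Measure.map_apply hp hs, hτ, withDensity_apply _ (hp hs)]
          _ ≤ ∫⁻ z in p ⁻¹' s, min (g (p z)) 1 ∂σ :=
              lintegral_mono' (Measure.restrict_mono_measure Measure.restrict_le_self _) le_rfl
          _ = ∫⁻ x in s, min (g x) 1 ∂(σ.map p) :=
              (setLIntegral_map hs (hgm.min measurable_const) hp).symm
          _ ≤ ∫⁻ x in s, g x ∂μ :=
              lintegral_mono' (Measure.restrict_mono_measure hσp _) fun x => min_le_left _ _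
          _ = lam s := hlamg s
      · have : (σ.restrict D) (q ⁻¹' {y | P.rnDeriv ν y ≤ a})ᶜ = 0 := by
          rw [Measure.restrict_apply (hq hAm).compl]
          have : (q ⁻¹' {y | P.rnDeriv ν y ≤ a})ᶜ ∩ D = ∅ := by
            ext z; simp only [hD]; simp; tauto
          rw [this, measure_empty]
        exact withDensity_absolutelyContinuous _ _ this
    have h1 : ∫⁻ z in D, min (g (p z)) 1 ∂σ = 0 := by
      have := congrArg (fun κ : Measure Z => κ Set.univ) hτ0
      simp only [hτ] at this
      rwa [withDensity_apply _ MeasurableSet.univ, Measure.restrict_univ, Measure.coe_zero,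
        Pi.zero_apply] at this
    rw [lintegral_eq_zero_iff hhm, Filter.EventuallyEq, ae_restrict_iff' hDm, ae_iff] at h1
    refine measure_mono_null (fun z hz => ?_) h1
    simp only [Set.mem_ofPred_eq, Classical.not_imp]
    refine ⟨hz, fun h0 => ?_⟩
    have hgz : g (p z) ≠ 0 := hz.1
    simp only [Pi.zero_apply] at h0
    rcases min_choice (g (p z)) 1 with h | h
    · rw [h] at h0; exact hgz h0
    · rw [h] at h0; exact one_ne_zero h0
  have hnull' : σ (p ⁻¹' H ∩ q ⁻¹' Uᶜ) = 0 := by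
    refine measure_mono_null (t := ⋃ k : ℚ, ⋃ _ : Real.toNNReal k < t,
      p ⁻¹' H ∩ q ⁻¹' {y | P.rnDeriv ν y ≤ (Real.toNNReal k : ℝ≥0)}) (fun z hz => ?_)
      (measure_iUnion_null fun k => measure_iUnion_null fun hk => hnull _ hk)
    have h1 : P.rnDeriv ν (q z) < t := not_le.1 hz.2
    obtain ⟨k, -, hk1, hk2⟩ := ENNReal.lt_iff_exists_rat_btwn.1 h1
    refine Set.mem_iUnion.2 ⟨k, Set.mem_iUnion.2 ⟨by exact_mod_cast hk2, hz.1, hk1.le⟩⟩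
  have hsmall : σ (q ⁻¹' Uᶜ) ≤ ∫⁻ y in Uᶜ, P.rnDeriv ν y ∂ν := by
    calc σ (q ⁻¹' Uᶜ) ≤ σ (p ⁻¹' H ∩ q ⁻¹' Uᶜ) + σ (p ⁻¹' Hᶜ) := by
          refine (measure_mono fun z hz => ?_).trans (measure_union_le _ _)
          by_cases h : p z ∈ H
          · exact Or.inl ⟨h, hz⟩
          · exact Or.inr h
      _ = σ.map p Hᶜ := by rw [hnull', zero_add, Measure.map_apply hp hHm.compl]
      _ ≤ μ Hᶜ := hσp _
      _ = π (p ⁻¹' Hᶜ) := by rw [← hπ.2.2, Measure.map_apply hp hHm.compl]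
      _ ≤ π (p ⁻¹' Hᶜ ∩ q ⁻¹' (U ∪ S)) + π (q ⁻¹' (U ∪ S)ᶜ) := by
          refine (measure_mono fun z hz => ?_).trans (measure_union_le _ _)
          by_cases h : q z ∈ U ∪ S
          · exact Or.inl ⟨hz, h⟩
          · exact Or.inr h
      _ = lam Hᶜ + P (U ∪ S)ᶜ := by
          rw [hlam, Measure.map_apply hp hHm.compl, Measure.restrict_apply (hp hHm.compl), hPdef,
            Measure.map_apply hq hBm.compl]
      _ = P (U ∪ S)ᶜ := by
          have : lam Hᶜ = 0 := by
            rw [← hlamg, setLIntegral_congr_fun (g := fun _ => 0) hHm.compl (fun x hx => by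
              simpa [hH] using hx)]
            simp
          rw [this, zero_add]
      _ = ∫⁻ y in (U ∪ S)ᶜ, P.rnDeriv ν y ∂ν := by
          rw [measure_eq_singularPart_add_setLIntegral P ν hBm.compl]
          have : P.singularPart ν (U ∪ S)ᶜ = 0 :=
            measure_mono_null (Set.compl_subset_compl.2 Set.subset_union_right) hPS
          rw [this, zero_add]
      _ ≤ ∫⁻ y in Uᶜ, P.rnDeriv ν y ∂ν :=
          lintegral_mono_set (Set.compl_subset_compl.2 Set.subset_union_left)
  calc σ Set.univ ≤ σ (q ⁻¹' U) + σ (q ⁻¹' Uᶜ) := by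
        rw [← Set.union_compl_self (q ⁻¹' U)]; exact measure_union_le _ _
    _ ≤ t * ν U + ∫⁻ y in Uᶜ, P.rnDeriv ν y ∂ν := by
        refine add_le_add ?_ hsmall
        rw [← Measure.map_apply hq hUm]
        exact hσq U
    _ = ∫⁻ y in U, min (P.rnDeriv ν y) t ∂ν + ∫⁻ y in Uᶜ, min (P.rnDeriv ν y) t ∂ν := by
        congr 1
        · rw [setLIntegral_congr_fun (g := fun _ => (t : ℝ≥0∞)) hUm (fun y hy => min_eq_right hy)]
          simp
        · exact setLIntegral_congr_fun hUm.compl (fun y hy => (min_eq_left (le_of_lt (not_le.1 fun h => hy h))).symm)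
    _ = ∫⁻ y, min (P.rnDeriv ν y) t ∂ν := lintegral_add_compl _ hUm

/-- The part of a plan below level `t`: rescaling the plan by `min r t / r`, off a carrier of the
singular part, gives a subplan below level `t` of mass `∫ min r t`. -/
theorem exists_subplan_mass_eq_lintegral_min (hp : Measurable p) (hq : Measurable q)
    (hπ : π ∈ liftsAlong E p μ) (t : ℝ≥0) :
    ∃ σ : Measure Z, IsFiniteMeasure σ ∧ σ Eᶜ = 0 ∧ σ.map p ≤ μ ∧ σ.map q ≤ t • ν ∧
      σ Set.univ = ∫⁻ y, min ((π.map q).rnDeriv ν y) t ∂ν := by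
  have hπfin : IsFiniteMeasure π := hπ.1
  obtain ⟨S, hS, hνS, hPS⟩ := exists_singular_carrier (π.map q) ν
  set P := π.map q with hPdef
  have hPfin : IsFiniteMeasure P := Measure.isFiniteMeasure_map π q
  have hrm : Measurable (P.rnDeriv ν) := P.measurable_rnDeriv ν
  set h : Y → ℝ≥0∞ := Sᶜ.indicator fun y => min (P.rnDeriv ν y) t / P.rnDeriv ν y with hh
  have hhm : Measurable h := ((hrm.min measurable_const).div hrm).indicator hS.compl
  have hh1 : ∀ y, h y ≤ 1 := fun y =>
    (Set.indicator_le_self' (fun _ _ => zero_le) y).trans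
      (ENNReal.div_le_of_le_mul (by rw [one_mul]; exact min_le_left _ _))
  have hPh : P.withDensity h = ν.withDensity fun y => min (P.rnDeriv ν y) t := by
    conv_lhs => rw [← Measure.singularPart_add_rnDeriv P ν]
    rw [withDensity_add_measure, hh, withDensity_indicator hS.compl,
      Measure.restrict_eq_zero.2 hPS, withDensity_zero_left, zero_add, ← hh,
      ← withDensity_mul _ hrm hhm]
    refine withDensity_congr_ae ?_
    have hSae : ∀ᵐ y ∂ν, y ∉ S := by
      rw [ae_iff]; simpa using hνS
    filter_upwards [hSae, P.rnDeriv_lt_top ν] with y hyS hylt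
    rw [Pi.mul_apply, hh, Set.indicator_of_mem (show y ∈ Sᶜ from hyS)]
    rcases eq_or_ne (P.rnDeriv ν y) 0 with h0 | h0
    · simp [h0]
    · exact ENNReal.mul_div_cancel h0 hylt.ne
  have hle : π.withDensity (fun z => h (q z)) ≤ π := withDensity_le_self fun z => hh1 _
  have hmapq : (π.withDensity fun z => h (q z)).map q = ν.withDensity fun y => min (P.rnDeriv ν y) t := by
    rw [map_withDensity_comp hq hhm, ← hPdef, hPh]
  refine ⟨π.withDensity fun z => h (q z), isFiniteMeasure_of_le π hle,
    le_antisymm ((hle _).trans hπ.2.1.le) bot_le, ?_, ?_, ?_⟩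
  · rw [← hπ.2.2]; exact Measure.map_mono hle hp
  · rw [hmapq]
    calc ν.withDensity (fun y => min (P.rnDeriv ν y) t) ≤ ν.withDensity fun _ => (t : ℝ≥0∞) :=
          withDensity_mono (Eventually.of_forall fun y => min_le_right _ _)
      _ = t • ν := by rw [withDensity_const]; rfl
  · rw [← Set.preimage_univ (f := q), ← Measure.map_apply hq MeasurableSet.univ, hmapq,
      withDensity_apply _ MeasurableSet.univ, Measure.restrict_univ]

end Exchange

/-! ### Almost everywhere measurable sections -/

section Section

/-- A continuous image of the Baire space is exhausted in measure by images of compact sets.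
The compact set is a product of initial segments of `ℕ`, chosen coordinate by coordinate so that
little outer measure of the image is lost at each step. -/
lemma exists_isCompact_measure_compl_image_le {X : Type*} [TopologicalSpace X] [PolishSpace X]
    [MeasurableSpace X] [BorelSpace X] {f : (ℕ → ℕ) → X} (hf : Continuous f)
    (hsurj : Function.Surjective f) (μ : Measure X) [IsFiniteMeasure μ] {ε : ℝ≥0∞} (hε : ε ≠ 0) :
    ∃ K : Set (ℕ → ℕ), IsCompact K ∧ μ (f '' K)ᶜ ≤ ε := by
  let := TopologicalSpace.upgradeIsCompletelyMetrizable X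
  obtain ⟨δ, hδ, hδε⟩ := ENNReal.exists_pos_sum_of_countable' hε ℕ
  have step : ∀ (A : Set (ℕ → ℕ)) (n : ℕ), ∃ k : ℕ,
      μ (f '' A) ≤ μ (f '' (A ∩ {z | z n ≤ k})) + δ n := by
    intro A n
    have hmono : Monotone fun k : ℕ => f '' (A ∩ {z | z n ≤ k}) := fun i j hij =>
      Set.image_mono (Set.inter_subset_inter_right _ fun z (hz : z n ≤ i) => hz.trans hij)
    have hun : ⋃ k : ℕ, f '' (A ∩ {z | z n ≤ k}) = f '' A := by
      rw [← Set.image_iUnion, ← Set.inter_iUnion]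
      congr 1
      refine Set.inter_eq_left.2 fun z _ => Set.mem_iUnion.2 ⟨z n, le_refl (z n)⟩
    have hsup := hmono.measure_iUnion (μ := μ)
    rw [hun] at hsup
    by_contra! hcon
    have h1 : μ (f '' A) + δ n ≤ μ (f '' A) := by
      conv_lhs => rw [hsup]
      rw [ENNReal.iSup_add]
      exact iSup_le fun k => (hcon k).le
    exact absurd h1 (not_le.2 (ENNReal.lt_add_right (measure_ne_top _ _) (hδ n).ne'))
  choose k hk using step
  let S : ℕ → Set (ℕ → ℕ) := fun n => Nat.rec Set.univ (fun n A => A ∩ {z | z n ≤ k A n}) n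
  have hS : ∀ n, S (n + 1) = S n ∩ {z | z n ≤ k (S n) n} := fun n => rfl
  set N : ℕ → ℕ := fun n => k (S n) n with hN
  have hSmem : ∀ n z, z ∈ S n ↔ ∀ i < n, z i ≤ N i := by
    intro n
    induction n with
    | zero => intro z; simp [S]
    | succ n ih =>
      intro z
      rw [hS, Set.mem_inter_iff, ih]
      constructor
      · rintro ⟨h1, h2⟩ i hi
        rcases Nat.lt_succ_iff_lt_or_eq.1 hi with h | rfl
        · exact h1 i h
        · exact h2
      · exact fun h => ⟨fun i hi => h i (hi.trans (Nat.lt_succ_self n)), h n (Nat.lt_succ_self n)⟩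
  have hmass : ∀ n, μ Set.univ ≤ μ (f '' S n) + ∑ i ∈ Finset.range n, δ i := by
    intro n
    induction n with
    | zero => simp [S, Set.image_univ, hsurj.range_eq]
    | succ n ih =>
      refine ih.trans ?_
      rw [Finset.sum_range_succ, hS]
      calc μ (f '' S n) + ∑ i ∈ Finset.range n, δ i
          ≤ (μ (f '' (S n ∩ {z | z n ≤ k (S n) n})) + δ n) + ∑ i ∈ Finset.range n, δ i :=
            add_le_add_left (hk (S n) n) _
        _ = _ := by ring
  set K : Set (ℕ → ℕ) := Set.pi Set.univ fun n => Set.Iic (N n) with hK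
  have hKc : IsCompact K := isCompact_univ_pi fun n => (Set.finite_Iic (N n)).isCompact
  refine ⟨K, hKc, ?_⟩
  have hsub : ⋂ n, closure (f '' S n) ⊆ f '' K := by
    intro x hx
    rw [Set.mem_iInter] at hx
    have : ∀ n : ℕ, ∃ z ∈ S n, dist x (f z) < 1 / ((n : ℝ) + 1) := fun n => by
      obtain ⟨_, ⟨z, hz, rfl⟩, hd⟩ := Metric.mem_closure_iff.1 (hx n) _ Nat.one_div_pos_of_nat
      exact ⟨z, hz, hd⟩
    choose z hz hd using this
    obtain ⟨w, hw, φ, hφ, hlim⟩ := hKc.tendsto_subseq (x := fun n i => min (z n i) (N i))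
      fun n i _ => min_le_right (z n i) (N i)
    have hzlim : Tendsto (z ∘ φ) atTop (nhds w) := by
      rw [tendsto_pi_nhds] at hlim ⊢
      intro i
      refine (hlim i).congr' ?_
      filter_upwards [hφ.tendsto_atTop.eventually_gt_atTop i] with n hn
      exact min_eq_left ((hSmem _ _).1 (hz (φ n)) i hn)
    have h1 : Tendsto (fun n => f (z (φ n))) atTop (nhds (f w)) := (hf.tendsto w).comp hzlim
    have h2 : Tendsto (fun n => f (z n)) atTop (nhds x) := by
      rw [tendsto_iff_dist_tendsto_zero]
      refine squeeze_zero (fun _ => dist_nonneg) (fun n => ?_) tendsto_one_div_add_atTop_nhds_zero_nat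
      rw [dist_comm]
      exact (hd n).le
    exact ⟨w, hw, tendsto_nhds_unique h1 (h2.comp hφ.tendsto_atTop)⟩
  have hanti : Antitone fun n => closure (f '' S n) := antitone_nat_of_succ_le fun n =>
    closure_mono (Set.image_mono (by rw [hS]; exact Set.inter_subset_left))
  have hlow : μ Set.univ ≤ μ (f '' K) + ε := by
    calc μ Set.univ ≤ μ (⋂ n, closure (f '' S n)) + ε := by
          rw [hanti.measure_iInter (fun n => isClosed_closure.measurableSet.nullMeasurableSet)
            ⟨0, measure_ne_top _ _⟩, ENNReal.iInf_add]
          refine le_iInf fun n => (hmass n).trans ?_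
          exact add_le_add (measure_mono subset_closure)
            ((ENNReal.sum_le_tsum _).trans hδε.le)
      _ ≤ _ := add_le_add_left (measure_mono hsub) _
  rw [measure_compl (hKc.image hf).measurableSet (measure_ne_top _ _)]
  exact tsub_le_iff_left.2 hlow

/-- A continuous map on a compact set has a measurable section over its image.  The compact set is
a continuous image of the Cantor space, which embeds in `ℝ`; the section selects the least point
of each fibre. -/
lemma IsCompact.exists_measurable_section {Z X : Type*} [TopologicalSpace Z] [PolishSpace Z]
    [MeasurableSpace Z] [BorelSpace Z] [TopologicalSpace X] [T2Space X] [MeasurableSpace X]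
    [BorelSpace X] {p : Z → X} (hp : Continuous p) {K : Set Z} (hK : IsCompact K)
    (hne : K.Nonempty) :
    ∃ s : X → Z, Measurable s ∧ ∀ x ∈ p '' K, s x ∈ K ∧ p (s x) = x := by
  let := TopologicalSpace.upgradeIsCompletelyMetrizable Z
  have : Nonempty K := hne.to_subtype
  have : CompactSpace K := isCompact_iff_compactSpace.1 hK
  obtain ⟨φ, hφ, hφs⟩ := exists_nat_bool_continuous_surjective_of_compact K
  let F : (ℕ → Bool) → X := fun b => p (φ b)
  have hF : Continuous F := hp.comp (continuous_subtype_val.comp hφ)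
  let e : (ℕ → Bool) → ℝ := fun b => cantorSetHomeomorphNatToBool.symm b
  have he : Continuous e := continuous_subtype_val.comp cantorSetHomeomorphNatToBool.symm.continuous
  have hei : Function.Injective e :=
    Subtype.val_injective.comp cantorSetHomeomorphNatToBool.symm.injective
  obtain ⟨g, hg, hge⟩ := (he.isClosedEmbedding hei).measurableEmbedding.exists_measurable_extend
    (g := id) measurable_id fun _ => inferInstance
  let m : X → ℝ := fun x => sInf (e '' (F ⁻¹' {x}))
  have hrange : Set.range F = p '' K := by
    ext x
    constructor
    · rintro ⟨b, rfl⟩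
      exact ⟨φ b, (φ b).2, rfl⟩
    · rintro ⟨z, hz, rfl⟩
      obtain ⟨b, hb⟩ := hφs ⟨z, hz⟩
      exact ⟨b, by simp [F, hb]⟩
  have hfib : ∀ x, IsCompact (e '' (F ⁻¹' {x})) := fun x =>
    ((isClosed_singleton.preimage hF).isCompact).image he
  have hmin : ∀ x ∈ Set.range F, ∃ b, F b = x ∧ e b = m x := by
    rintro x ⟨b₀, hb₀⟩
    obtain ⟨b, hb, hbm⟩ := (hfib x).sInf_mem ⟨_, b₀, hb₀, rfl⟩
    exact ⟨b, hb, hbm⟩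
  have hm : Measurable m := by
    refine measurable_of_Iic fun c => ?_
    have : m ⁻¹' Set.Iic c = F '' (e ⁻¹' Set.Iic c) ∪ ((Set.range F)ᶜ ∩ {_x | (0 : ℝ) ≤ c}) := by
      ext x
      by_cases hx : x ∈ Set.range F
      · obtain ⟨b, hb, hbm⟩ := hmin x hx
        constructor
        · intro h
          exact Or.inl ⟨b, by rw [Set.mem_preimage, hbm]; exact h, hb⟩
        · rintro (⟨b', hb', rfl⟩ | h)
          · exact (csInf_le (hfib _).bddBelow ⟨b', rfl, rfl⟩).trans hb'
          · exact absurd hx h.1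
      · have hm0 : m x = 0 := by
          have : F ⁻¹' {x} = ∅ := by
            ext b; simp only [Set.mem_preimage, Set.mem_singleton_iff, Set.mem_empty_iff_false, iff_false]
            exact fun h => hx ⟨b, h⟩
          simp [m, this]
        constructor
        · intro h
          refine Or.inr ⟨hx, ?_⟩
          have : m x ≤ c := h
          rwa [hm0] at this
        · rintro (⟨b', -, rfl⟩ | h)
          · exact absurd ⟨b', rfl⟩ hx
          · change m x ≤ c
            rw [hm0]; exact h.2
    rw [this]
    refine ((((isClosed_Iic.preimage he).isCompact).image hF).measurableSet).union
      ((isCompact_range hF).measurableSet.compl.inter (MeasurableSet.const _))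
  refine ⟨fun x => φ (g (m x)), (continuous_subtype_val.comp hφ).measurable.comp (hg.comp hm), ?_⟩
  intro x hx
  rw [← hrange] at hx
  obtain ⟨b, hb, hbm⟩ := hmin x hx
  have : g (m x) = b := by rw [← hbm]; exact congrFun hge b
  simp only [this]
  exact ⟨(φ b).2, hb⟩

/-- A continuous map that sends a closed subset of a Polish space onto a Polish space has a
measurable section into that subset, defined almost everywhere. -/
theorem IsClosed.exists_measurable_ae_section {Z X : Type*} [TopologicalSpace Z] [PolishSpace Z]
    [MeasurableSpace Z] [BorelSpace Z] [TopologicalSpace X] [PolishSpace X] [MeasurableSpace X]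
    [BorelSpace X] {p : Z → X} (hp : Continuous p) {E : Set Z} (hE : IsClosed E)
    (hsurj : ∀ x, ∃ z ∈ E, p z = x) (μ : Measure X) [IsFiniteMeasure μ] :
    ∃ s : X → Z, Measurable s ∧ ∀ᵐ x ∂μ, s x ∈ E ∧ p (s x) = x := by
  rcases isEmpty_or_nonempty X with hX | hX
  · exact ⟨isEmptyElim, measurable_of_empty _, by
      rw [μ.eq_zero_of_isEmpty]; simp⟩
  have : Nonempty E := by
    obtain ⟨z, hz, -⟩ := hsurj hX.some
    exact ⟨⟨z, hz⟩⟩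
  have : PolishSpace E := hE.polishSpace
  obtain ⟨F, hF, hFs⟩ := PolishSpace.exists_nat_nat_continuous_surjective E
  have hf : Continuous fun b => p (F b) := hp.comp (continuous_subtype_val.comp hF)
  have hfs : Function.Surjective fun b => p (F b) := by
    intro x
    obtain ⟨z, hz, rfl⟩ := hsurj x
    obtain ⟨b, hb⟩ := hFs ⟨z, hz⟩
    exact ⟨b, by simp [hb]⟩
  have hex : ∀ n : ℕ, ∃ K : Set Z, IsCompact K ∧ K ⊆ E ∧ μ (p '' K)ᶜ ≤ ((n : ℝ≥0∞) + 1)⁻¹ := by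
    intro n
    obtain ⟨K, hK, hKμ⟩ := exists_isCompact_measure_compl_image_le hf hfs μ
      (ε := ((n : ℝ≥0∞) + 1)⁻¹) (by simp)
    refine ⟨(fun b => (F b : Z)) '' K, hK.image (continuous_subtype_val.comp hF), ?_, ?_⟩
    · rintro _ ⟨b, -, rfl⟩
      exact (F b).2
    · rwa [Set.image_image]
  choose K hK hKE hKμ using hex
  have z₀ : Z := ((Classical.arbitrary E : E) : Z)
  have hsec : ∀ n, ∃ s : X → Z, Measurable s ∧ ∀ x ∈ p '' K n, s x ∈ K n ∧ p (s x) = x := by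
    intro n
    rcases (K n).eq_empty_or_nonempty with h | h
    · exact ⟨fun _ => z₀, measurable_const, by simp [h]⟩
    · exact (hK n).exists_measurable_section hp h
  choose s hs hsx using hsec
  have hmeas : ∀ n, MeasurableSet (p '' K n) := fun n => ((hK n).image hp).measurableSet
  obtain ⟨f, hfm, hfeq⟩ := exists_measurable_piecewise (disjointed fun n => p '' K n)
    (fun n => MeasurableSet.disjointed hmeas n) s hs (fun i j hij x hx =>
      absurd hx.2 (Set.disjoint_left.1 (disjoint_disjointed _ hij) hx.1))
  refine ⟨f, hfm, ?_⟩
  have hnull : μ (⋃ n, p '' K n)ᶜ = 0 := by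
    refine le_antisymm (ENNReal.le_of_forall_pos_le_add fun ε hε _ => ?_) bot_le
    obtain ⟨n, hn⟩ := ENNReal.exists_inv_nat_lt (a := (ε : ℝ≥0∞)) (by exact_mod_cast hε.ne')
    rw [zero_add]
    calc μ (⋃ n, p '' K n)ᶜ ≤ μ (p '' K n)ᶜ :=
          measure_mono (Set.compl_subset_compl.2 (Set.subset_iUnion (fun n => p '' K n) n))
      _ ≤ ((n : ℝ≥0∞) + 1)⁻¹ := hKμ n
      _ ≤ (n : ℝ≥0∞)⁻¹ := ENNReal.inv_le_inv.2 le_self_add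
      _ ≤ ε := hn.le
  have hae : ∀ᵐ x ∂μ, x ∈ ⋃ n, p '' K n := by
    rw [ae_iff]; exact hnull
  filter_upwards [hae] with x hx
  rw [← iUnion_disjointed] at hx
  obtain ⟨n, hn⟩ := Set.mem_iUnion.1 hx
  rw [hfeq n hn]
  have := hsx n x (disjointed_subset _ n hn)
  exact ⟨hKE n this.1, this.2⟩

end Section

/-! ### Weak limits of plans -/

section WeakLimits

open scoped BoundedContinuousFunction

/-- A finite measure on a Polish space that is dominated on bounded continuous functions is
dominated on all measurable sets. -/
lemma measure_le_of_forall_lintegral_boundedContinuous_le {X : Type*} [TopologicalSpace X]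
    [PolishSpace X] [MeasurableSpace X] [BorelSpace X] {ρ μ : Measure X} [IsFiniteMeasure ρ]
    [IsFiniteMeasure μ] (h : ∀ f : X →ᵇ ℝ≥0, ∫⁻ x, f x ∂ρ ≤ ∫⁻ x, f x ∂μ) : ρ ≤ μ := by
  let := TopologicalSpace.upgradeIsCompletelyMetrizable X
  have hclosed : ∀ F : Set X, IsClosed F → ρ F ≤ μ F := fun F hF =>
    le_of_tendsto_of_tendsto' (HasOuterApproxClosed.tendsto_lintegral_apprSeq hF ρ)
      (HasOuterApproxClosed.tendsto_lintegral_apprSeq hF μ) fun n => h (hF.apprSeq n)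
  rw [Measure.le_iff]
  intro s hs
  rw [hs.measure_eq_iSup_isClosed_of_ne_top (measure_ne_top _ _)]
  exact iSup_le fun F => iSup_le fun hFs => iSup_le fun hF =>
    (hclosed F hF).trans (measure_mono hFs)

variable {Z X Y : Type*}
  [TopologicalSpace Z] [PolishSpace Z] [MeasurableSpace Z] [BorelSpace Z]
  [TopologicalSpace X] [PolishSpace X] [MeasurableSpace X] [BorelSpace X]
  [TopologicalSpace Y] [PolishSpace Y] [MeasurableSpace Y] [BorelSpace Y]
  {p : Z → X} {q : Z → Y} {E : Set Z}

lemma exists_isCompact_measure_compl_le (μ : Measure X) [IsFiniteMeasure μ] {ε : ℝ≥0∞}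
    (hε : 0 < ε) : ∃ K : Set X, IsCompact K ∧ μ Kᶜ ≤ ε := by
  obtain ⟨K, hK, h⟩ := isTightMeasureSet_iff_exists_isCompact_measure_compl_le.1
    (isTightMeasureSet_singleton (μ := μ)) ε hε
  exact ⟨K, hK, h μ rfl⟩

/-- Measures with both marginals dominated by fixed finite measures lie in a weakly compact set. -/
lemma exists_isCompact_of_marginals_le (hp : Measurable p) (hq : Measurable q)
    (hproper : ∀ A B, IsCompact A → IsCompact B → IsCompact (p ⁻¹' A ∩ q ⁻¹' B))
    (μ : Measure X) [IsFiniteMeasure μ] (ν : Measure Y) [IsFiniteMeasure ν] :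
    ∃ C : Set (FiniteMeasure Z), IsCompact C ∧ ∀ ζ : FiniteMeasure Z,
      (ζ : Measure Z).map p ≤ μ → (ζ : Measure Z).map q ≤ ν → ζ ∈ C := by
  have hpos : ∀ n : ℕ, (0 : ℝ≥0∞) < ((1 / ((n : ℝ≥0) + 1) : ℝ≥0) : ℝ≥0∞) := fun n => by
    rw [ENNReal.coe_pos]; positivity
  choose A hA hAμ using fun n : ℕ => exists_isCompact_measure_compl_le μ (hpos n)
  choose B hB hBν using fun n : ℕ => exists_isCompact_measure_compl_le ν (hpos n)
  have hu : Tendsto (fun n : ℕ => 1 / ((n : ℝ≥0) + 1) + 1 / ((n : ℝ≥0) + 1)) atTop (nhds 0) := by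
    have := tendsto_one_div_add_atTop_nhds_zero_nat (𝕜 := ℝ≥0)
    simpa using this.add this
  let := TopologicalSpace.upgradeIsCompletelyMetrizable Z
  refine ⟨_, isCompact_setOfPred_finiteMeasure_mass_le_compl_isCompact_le (μ Set.univ).toNNReal hu
    (fun n => hproper (A n) (B n) (hA n) (hB n)) (Or.inl inferInstance),
    fun ζ hζp hζq => ⟨?_, fun n => ?_⟩⟩
  · refine ENNReal.toNNReal_mono (measure_ne_top _ _) ?_
    have := hζp Set.univ
    rwa [Measure.map_apply hp MeasurableSet.univ, Set.preimage_univ] at this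
  · rw [← ENNReal.coe_le_coe, FiniteMeasure.ennreal_coeFn_eq_coeFn_toMeasure, Set.compl_inter,
      ENNReal.coe_add]
    refine (measure_union_le _ _).trans (add_le_add ?_ ?_)
    · rw [← Set.preimage_compl, ← Measure.map_apply hp (hA n).isClosed.measurableSet.compl]
      exact (hζp _).trans (hAμ n)
    · rw [← Set.preimage_compl, ← Measure.map_apply hq (hB n).isClosed.measurableSet.compl]
      exact (hζq _).trans (hBν n)

/-- Prokhorov compactness along an ultrafilter, for plans on a closed set with dominated
marginals. -/
lemma exists_weak_limit_of_marginals_le {ι : Type*} (U : Ultrafilter ι) (hp : Measurable p)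
    (hq : Measurable q)
    (hproper : ∀ A B, IsCompact A → IsCompact B → IsCompact (p ⁻¹' A ∩ q ⁻¹' B))
    (hE : IsClosed E) (μ : Measure X) [IsFiniteMeasure μ] (ν : Measure Y) [IsFiniteMeasure ν]
    {ζ : ι → Measure Z} (hfin : ∀ i, IsFiniteMeasure (ζ i)) (hζE : ∀ i, ζ i Eᶜ = 0)
    (hζp : ∀ i, (ζ i).map p ≤ μ) (hζq : ∀ i, (ζ i).map q ≤ ν) :
    ∃ ξ : Measure Z, IsFiniteMeasure ξ ∧ ξ Eᶜ = 0 ∧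
      ∀ f : Z →ᵇ ℝ≥0, Tendsto (fun i => ∫⁻ z, f z ∂ζ i) U (nhds (∫⁻ z, f z ∂ξ)) := by
  let := TopologicalSpace.upgradeIsCompletelyMetrizable Z
  obtain ⟨C, hC, hmem⟩ := exists_isCompact_of_marginals_le hp hq hproper μ ν
  let F : ι → FiniteMeasure Z := fun i => ⟨ζ i, hfin i⟩
  obtain ⟨ξ, -, hξ⟩ := hC.ultrafilter_le_nhds (U.map F) (by
    rw [Ultrafilter.coe_map, le_principal_iff]
    exact mem_map.2 (Eventually.of_forall fun i => hmem (F i) (hζp i) (hζq i)))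
  have hlim : Tendsto F U (nhds ξ) := hξ
  have hint := FiniteMeasure.tendsto_iff_forall_lintegral_tendsto.1 hlim
  refine ⟨ξ, inferInstance, ?_, hint⟩
  -- The total mass passes to the limit and the mass of a closed set can only increase.
  have h1 := FiniteMeasure.limsup_measure_closed_le_of_tendsto hlim hE
  have h2 : ∀ i, (F i : Measure Z) E = (F i : Measure Z) Set.univ := fun i => by
    rw [← measure_add_measure_compl (μ := (F i : Measure Z)) hE.measurableSet]
    change _ = _ + ζ i Eᶜ
    rw [hζE i, add_zero]
  have h3 : Tendsto (fun i => (F i : Measure Z) E) U (nhds ((ξ : Measure Z) Set.univ)) := by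
    simp_rw [h2]
    simpa using hint 1
  rw [h3.limsup_eq] at h1
  rw [measure_compl hE.measurableSet (measure_ne_top _ _)]
  exact tsub_eq_zero_of_le h1

/-- A plan on `E` with `p`-marginal at most `μ` extends to a lift of `μ`: the missing part of `μ` is
added along a section of `p`. -/
lemma exists_mem_liftsAlong_ge (hp : Continuous p) (hE : IsClosed E)
    (hsurj : ∀ x, ∃ z ∈ E, p z = x) (μ : Measure X) [IsFiniteMeasure μ] {σ : Measure Z}
    (hσE : σ Eᶜ = 0) (hσ : σ.map p ≤ μ) : ∃ π ∈ liftsAlong E p μ, σ ≤ π := by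
  obtain ⟨s, hs, hsE⟩ := hE.exists_measurable_ae_section hp hsurj μ
  have hσpfin : IsFiniteMeasure (σ.map p) := isFiniteMeasure_of_le μ hσ
  have hσfin : IsFiniteMeasure σ := ⟨by
    rw [← Set.preimage_univ (f := p), ← Measure.map_apply hp.measurable MeasurableSet.univ]
    exact measure_lt_top _ _⟩
  set μ' := μ - σ.map p with hμ'
  have hle : μ' ≤ μ := Measure.sub_le
  have hμ'fin : IsFiniteMeasure μ' := isFiniteMeasure_of_le μ hle
  have hae : ∀ᵐ x ∂μ', s x ∈ E ∧ p (s x) = x :=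
    (Measure.absolutelyContinuous_of_le hle).ae_le hsE
  have hfin' : IsFiniteMeasure (μ'.map s) := Measure.isFiniteMeasure_map _ _
  refine ⟨μ'.map s + σ, ⟨inferInstance, ?_, ?_⟩, Measure.le_add_left le_rfl⟩
  · rw [Measure.add_apply, hσE, add_zero, Measure.map_apply hs hE.measurableSet.compl]
    have hnull : μ' {x | ¬ (s x ∈ E ∧ p (s x) = x)} = 0 := ae_iff.1 hae
    refine measure_mono_null (fun x hx => ?_) hnull
    exact fun h => hx h.1
  · have : p ∘ s =ᵐ[μ'] id := hae.mono fun x hx => hx.2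
    rw [Measure.map_add _ _ hp.measurable, Measure.map_map hp.measurable hs, Measure.map_congr this,
      Measure.map_id, hμ', Measure.sub_add_cancel_of_le hσ]

/-- If the densities of the opposite marginals of lifts of `μ` converge almost everywhere to `r`,
then some lift of `μ` has an opposite marginal of density at least `r`.  On each of the sets where
`k ≤ sup r_n < k + 1` the marginals are dominated, so the restricted plans have a weak limit.  The
sum of these limits over `k` has opposite marginal `r ν`, and the part of `μ` that it misses is
added along a section. -/
theorem exists_mem_liftsAlong_withDensity_le (hp : Continuous p) (hq : Continuous q)
    (hproper : ∀ A B, IsCompact A → IsCompact B → IsCompact (p ⁻¹' A ∩ q ⁻¹' B))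
    (hE : IsClosed E) (hsurj : ∀ x, ∃ z ∈ E, p z = x)
    {μ : Measure X} [IsFiniteMeasure μ] {ν : Measure Y} [IsFiniteMeasure ν]
    {π : ℕ → Measure Z} (hπ : ∀ n, π n ∈ liftsAlong E p μ) {r : Y → ℝ≥0∞} (hr : Measurable r)
    (hlim : ∀ᵐ y ∂ν, r y ≠ ⊤ ∧
      Tendsto (fun n => ((π n).map q).rnDeriv ν y) atTop (nhds (r y))) :
    ∃ ξ ∈ liftsAlong E p μ, ν.withDensity r ≤ ξ.map q := by
  have hπfin : ∀ n, IsFiniteMeasure (π n) := fun n => (hπ n).1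
  have hPfin : ∀ n, IsFiniteMeasure ((π n).map q) := fun n => Measure.isFiniteMeasure_map _ _
  choose S hS hνS hPS using fun n => exists_singular_carrier ((π n).map q) ν
  set R : ℕ → Y → ℝ≥0∞ := fun n => ((π n).map q).rnDeriv ν with hR
  have hRm : ∀ n, Measurable (R n) := fun n => Measure.measurable_rnDeriv _ _
  set M : Y → ℝ≥0∞ := fun y => ⨆ n, R n y with hM
  have hMm : Measurable M := Measurable.iSup hRm
  have hMfin : ∀ᵐ y ∂ν, M y < ⊤ := by
    filter_upwards [hlim, ae_all_iff.2 fun n => ((π n).map q).rnDeriv_lt_top ν] with y hy hn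
    have h1 : Tendsto (fun n => (R n y).toNNReal) atTop (nhds (r y).toNNReal) :=
      (ENNReal.tendsto_toNNReal hy.1).comp hy.2
    obtain ⟨b, hb⟩ := h1.bddAbove_range
    refine lt_of_le_of_lt (iSup_le fun n => ?_) (ENNReal.coe_lt_top (r := b))
    rw [← ENNReal.coe_toNNReal (show R n y ≠ ⊤ from (hn n).ne)]
    exact ENNReal.coe_le_coe.2 (hb ⟨n, rfl⟩)
  set W : ℕ → Set Y := fun k => {y | (k : ℝ≥0∞) ≤ M y ∧ M y < (k : ℝ≥0∞) + 1} \ ⋃ n, S n with hW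
  have hWm : ∀ k, MeasurableSet (W k) := fun k =>
    ((measurableSet_le measurable_const hMm).inter (measurableSet_lt hMm measurable_const)).diff
      (MeasurableSet.iUnion hS)
  have hWdisj : Pairwise (Function.onFun Disjoint W) := by
    intro i j hij
    refine Set.disjoint_left.2 fun y hi hj => hij ?_
    have h1 := lt_of_le_of_lt hi.1.1 hj.1.2
    have h2 := lt_of_le_of_lt hj.1.1 hi.1.2
    have h1' : i < j + 1 := by exact_mod_cast h1
    have h2' : j < i + 1 := by exact_mod_cast h2
    omega
  have hWcover : ∀ᵐ y ∂ν, y ∈ ⋃ k, W k := by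
    have hSae : ∀ᵐ y ∂ν, y ∉ ⋃ n, S n := by
      rw [ae_iff]
      simp only [not_not]
      exact measure_iUnion_null hνS
    filter_upwards [hMfin, hSae] with y hy hyS
    refine Set.mem_iUnion.2 ⟨⌊(M y).toNNReal⌋₊, ⟨?_, ?_⟩, hyS⟩
    · conv_rhs => rw [← ENNReal.coe_toNNReal hy.ne]
      exact_mod_cast Nat.floor_le zero_le
    · conv_lhs => rw [← ENNReal.coe_toNNReal hy.ne]
      exact_mod_cast Nat.lt_floor_add_one (M y).toNNReal
  have hrW : ∀ k, ∀ᵐ y ∂ν, y ∈ W k → ∀ n, R n y ≤ ((k + 1 : ℕ) : ℝ≥0∞) := fun k =>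
    Eventually.of_forall fun y hy n => (le_iSup (fun n => R n y) n).trans (by
      push_cast; exact hy.1.2.le)
  -- The pieces of the plans over `W k`.
  set ζ : ℕ → ℕ → Measure Z := fun k n => (π n).restrict (q ⁻¹' W k) with hζ
  have hζle : ∀ k n, ζ k n ≤ π n := fun k n => Measure.restrict_le_self
  have hζfin : ∀ k n, IsFiniteMeasure (ζ k n) := fun k n => inferInstance
  have hζE : ∀ k n, ζ k n Eᶜ = 0 := fun k n =>
    le_antisymm ((hζle k n _).trans (hπ n).2.1.le) bot_le
  have hζp : ∀ k n, (ζ k n).map p ≤ μ := fun k n => by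
    rw [← (hπ n).2.2]; exact Measure.map_mono (hζle k n) hp.measurable
  have hζq : ∀ k n, (ζ k n).map q = (ν.restrict (W k)).withDensity (R n) := by
    intro k n
    have h0 : (((π n).map q).singularPart ν).restrict (W k) = 0 :=
      Measure.restrict_eq_zero.2 (measure_mono_null
        (fun y hy => fun h => hy.2 (Set.mem_iUnion.2 ⟨n, h⟩)) (hPS n))
    rw [hζ, ← Measure.restrict_map hq.measurable (hWm k)]
    conv_lhs => rw [← Measure.singularPart_add_rnDeriv ((π n).map q) ν]
    rw [Measure.restrict_add, h0, zero_add, restrict_withDensity (hWm k)]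
  have hζqle : ∀ k n, (ζ k n).map q ≤ ((k + 1 : ℕ) : ℝ≥0) • ν := by
    intro k n
    rw [hζq]
    calc (ν.restrict (W k)).withDensity (R n)
        ≤ (ν.restrict (W k)).withDensity (fun _ => ((k + 1 : ℕ) : ℝ≥0∞)) :=
          withDensity_mono ((ae_restrict_iff' (hWm k)).2 ((hrW k).mono fun y hy h => hy h n))
      _ = ((k + 1 : ℕ) : ℝ≥0∞) • ν.restrict (W k) := withDensity_const _
      _ ≤ ((k + 1 : ℕ) : ℝ≥0∞) • ν := by
          gcongr
          exact Measure.restrict_le_self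
      _ = ((k + 1 : ℕ) : ℝ≥0) • ν := by
          ext s _
          simp [ENNReal.smul_def]
  let U : Ultrafilter ℕ := Ultrafilter.of atTop
  have hU : (U : Filter ℕ) ≤ atTop := Ultrafilter.of_le _
  have hex := fun k => exists_weak_limit_of_marginals_le U hp.measurable hq.measurable hproper hE μ
    (((k + 1 : ℕ) : ℝ≥0) • ν) (hζfin k) (hζE k) (hζp k) (hζqle k)
  choose δ hδfin hδE hδlim using hex
  have hδq : ∀ k, (δ k).map q = (ν.withDensity r).restrict (W k) := by
    intro k
    have : IsFiniteMeasure ((δ k).map q) := Measure.isFiniteMeasure_map _ _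
    let := TopologicalSpace.upgradeIsCompletelyMetrizable Y
    refine ext_of_forall_lintegral_eq_of_IsFiniteMeasure fun f => ?_
    have hfm := BoundedContinuousFunction.measurable_coe_ennreal_comp f
    have h1 : Tendsto (fun n => ∫⁻ y, f y ∂((ζ k n).map q)) U (nhds (∫⁻ y, f y ∂((δ k).map q))) := by
      have := hδlim k (f.compContinuous ⟨q, hq⟩)
      simp only [lintegral_map hfm hq.measurable]
      exact this
    have h2 : Tendsto (fun n => ∫⁻ y, f y ∂((ζ k n).map q)) atTop
        (nhds (∫⁻ y, f y ∂((ν.withDensity r).restrict (W k)))) := by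
      simp only [hζq, restrict_withDensity (hWm k),
        lintegral_withDensity_eq_lintegral_mul _ (hRm _) hfm,
        lintegral_withDensity_eq_lintegral_mul _ hr hfm]
      refine tendsto_lintegral_of_dominated_convergence (fun y => ((k + 1 : ℕ) : ℝ≥0∞) * f y)
        (fun n => (hRm n).mul hfm) (fun n => ?_) ?_ ?_
      · refine (ae_restrict_iff' (hWm k)).2 ((hrW k).mono fun y hy h => ?_)
        exact mul_le_mul_left (hy h n) _
      · rw [lintegral_const_mul _ hfm]
        exact ENNReal.mul_ne_top (ENNReal.natCast_ne_top _)
          (f.lintegral_lt_top_of_nnreal (ν.restrict (W k))).ne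
      · refine ae_restrict_of_ae (hlim.mono fun y hy => ?_)
        exact ENNReal.Tendsto.mul_const hy.2 (Or.inr ENNReal.coe_ne_top)
    exact tendsto_nhds_unique h1 (h2.mono_left hU)
  have hσp : (Measure.sum δ).map p ≤ μ := by
    have hpart : ∀ T : Finset ℕ, (∑ k ∈ T, δ k).map p ≤ μ := by
      intro T
      have : IsFiniteMeasure ((∑ k ∈ T, δ k).map p) := Measure.isFiniteMeasure_map _ _
      refine measure_le_of_forall_lintegral_boundedContinuous_le fun f => ?_
      have hfm := BoundedContinuousFunction.measurable_coe_ennreal_comp f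
      have h1 : Tendsto (fun n => ∑ k ∈ T, ∫⁻ z, f (p z) ∂(ζ k n)) U
          (nhds (∑ k ∈ T, ∫⁻ z, f (p z) ∂(δ k))) :=
        tendsto_finsetSum T fun k _ => hδlim k (f.compContinuous ⟨p, hp⟩)
      rw [lintegral_map hfm hp.measurable, lintegral_finsetSum_measure]
      refine le_of_tendsto h1 (Eventually.of_forall fun n => ?_)
      rw [← lintegral_finsetSum_measure, ← (hπ n).2.2, lintegral_map hfm hp.measurable]
      refine lintegral_mono' ?_ le_rfl
      rw [Measure.le_iff]
      intro s hs
      rw [Measure.coe_finsetSum, Finset.sum_apply]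
      calc ∑ k ∈ T, ζ k n s ≤ ∑' k, ζ k n s := ENNReal.sum_le_tsum T
        _ = ((π n).restrict (⋃ k, q ⁻¹' W k)) s := by
            rw [Measure.restrict_iUnion (fun i j hij => (hWdisj hij).preimage q)
              (fun k => hq.measurable (hWm k)), Measure.sum_apply _ hs]
        _ ≤ π n s := Measure.restrict_le_self _
    rw [Measure.le_iff]
    intro s hs
    rw [Measure.map_apply hp.measurable hs, Measure.sum_apply _ (hp.measurable hs)]
    rw [ENNReal.tsum_eq_iSup_sum]
    refine iSup_le fun T => ?_
    have := hpart T s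
    rwa [Measure.map_apply hp.measurable hs, Measure.coe_finsetSum, Finset.sum_apply] at this
  have hσE : Measure.sum δ Eᶜ = 0 := by
    rw [Measure.sum_apply _ hE.measurableSet.compl]
    simp [hδE]
  obtain ⟨ξ, hξ, hσξ⟩ := exists_mem_liftsAlong_ge hp hE hsurj μ hσE hσp
  refine ⟨ξ, hξ, ?_⟩
  refine le_trans (le_of_eq ?_) (Measure.map_mono hσξ hq.measurable)
  rw [Measure.map_sum hq.measurable.aemeasurable]
  simp only [hδq]
  rw [← Measure.restrict_iUnion hWdisj hWm, Measure.restrict_eq_self_of_ae_mem]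
  exact (withDensity_absolutelyContinuous ν r).ae_le hWcover

end WeakLimits

/-! ### Minimizing the exponential divergence -/

section ExponentialCost

variable {Y : Type*} [MeasurableSpace Y]

/-- A sequence of functions bounded by one that is Cauchy in `L²`, with an explicit rate, has an
almost everywhere convergent subsequence. -/
lemma exists_subseq_tendsto_ae_of_integral_sq_sub_le {ν : Measure Y} [IsFiniteMeasure ν]
    {u : ℕ → Y → ℝ} (hu : ∀ n, Measurable (u n)) (hb : ∀ n y, |u n y| ≤ 1)
    (hc : ∀ n m : ℕ, ∫ y, (u n y - u m y) ^ 2 ∂ν ≤ 1 / ((n : ℝ) + 1) + 1 / ((m : ℝ) + 1)) :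
    ∃ (φ : ℕ → ℕ) (g : Y → ℝ), StrictMono φ ∧
      ∀ᵐ y ∂ν, Tendsto (fun n => u (φ n) y) atTop (nhds (g y)) := by
  have hmem : ∀ n, MemLp (u n) 2 ν := fun n =>
    MemLp.of_bound (hu n).aestronglyMeasurable 1 (Eventually.of_forall fun y => hb n y)
  have hnorm : ∀ n m, ‖(hmem n).toLp - (hmem m).toLp‖ ^ 2 = ∫ y, (u n y - u m y) ^ 2 ∂ν := by
    intro n m
    rw [← MemLp.toLp_sub, ← real_inner_self_eq_norm_sq, L2.inner_def]
    refine integral_congr_ae ?_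
    filter_upwards [((hmem n).sub (hmem m)).coeFn_toLp] with y hy
    rw [hy, Pi.sub_apply]
    simp [pow_two]
  have hcauchy : CauchySeq fun n => (hmem n).toLp := by
    rw [Metric.cauchySeq_iff]
    intro ε hε
    obtain ⟨N, hN⟩ := exists_nat_one_div_lt (show (0 : ℝ) < ε ^ 2 / 2 by positivity)
    refine ⟨N, fun n hn m hm => ?_⟩
    rw [dist_eq_norm]
    refine lt_of_pow_lt_pow_left₀ 2 hε.le ?_
    rw [hnorm]
    have h1 := Nat.one_div_le_one_div (α := ℝ) hn
    have h2 := Nat.one_div_le_one_div (α := ℝ) hm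
    linarith [hc n m]
  obtain ⟨g, hg⟩ := cauchySeq_tendsto_of_complete hcauchy
  obtain ⟨φ, hφ, hlim⟩ := (tendstoInMeasure_of_tendsto_Lp hg).exists_seq_tendsto_ae
  refine ⟨φ, g, hφ, ?_⟩
  filter_upwards [hlim, ae_all_iff.2 fun n => (hmem n).coeFn_toLp] with y hy hn
  simpa only [hn] using hy

/-- If the functions `exp (-R n / 2)` converge almost everywhere and the `R n` have bounded
integrals, then the `R n` converge almost everywhere to a finite limit: by Fatou's lemma, the
limit of the exponentials does not vanish. -/
lemma ae_tendsto_liminf_of_tendsto_exp {ν : Measure Y} {R : ℕ → Y → ℝ≥0∞}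
    (hR : ∀ n, Measurable (R n)) (hRfin : ∀ n, ∀ᵐ y ∂ν, R n y < ⊤) {C : ℝ≥0∞} (hC : C ≠ ⊤)
    (hRC : ∀ n, ∫⁻ y, R n y ∂ν ≤ C) {g : Y → ℝ}
    (hlim : ∀ᵐ y ∂ν, Tendsto (fun n => Real.exp (-(R n y).toReal / 2)) atTop (nhds (g y))) :
    ∀ᵐ y ∂ν, liminf (fun n => R n y) atTop ≠ ⊤ ∧
      Tendsto (fun n => R n y) atTop (nhds (liminf (fun n => R n y) atTop)) := by
  have hfatou : ∫⁻ y, liminf (fun n => R n y) atTop ∂ν ≤ C :=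
    (lintegral_liminf_le hR).trans
      ((liminf_le_liminf (Eventually.of_forall hRC)).trans (liminf_const C).le)
  have hfin : ∀ᵐ y ∂ν, liminf (fun n => R n y) atTop < ⊤ :=
    ae_lt_top (Measurable.liminf hR) (ne_top_of_le_ne_top hC hfatou)
  filter_upwards [hfin, hlim, ae_all_iff.2 hRfin] with y hy hg hn
  refine ⟨hy.ne, ?_⟩
  have hRn : ∀ n, R n y = ENNReal.ofReal (R n y).toReal := fun n =>
    (ENNReal.ofReal_toReal (hn n).ne).symm
  have hg0 : 0 ≤ g y := ge_of_tendsto' hg fun n => (Real.exp_pos _).le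
  rcases hg0.eq_or_lt with h0 | hpos
  · rw [← h0, Real.tendsto_exp_comp_nhds_zero] at hg
    have h1 : Tendsto (fun n => (R n y).toReal) atTop atTop := by
      have := (tendsto_neg_atBot_atTop.comp hg).const_mul_atTop (show (0 : ℝ) < 2 by norm_num)
      refine this.congr fun n => ?_
      simp only [Function.comp_apply]
      ring
    have h2 : Tendsto (fun n => R n y) atTop (nhds ⊤) :=
      (ENNReal.tendsto_ofReal_atTop.comp h1).congr fun n => (hRn n).symm
    exact absurd h2.liminf_eq hy.ne
  · have h1 : Tendsto (fun n => (R n y).toReal) atTop (nhds (-2 * Real.log (g y))) := by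
      have := ((Real.continuousAt_log hpos.ne').tendsto.comp hg).const_mul (-2)
      refine this.congr fun n => ?_
      simp only [Function.comp_apply, Real.log_exp]
      ring
    have h2 : Tendsto (fun n => R n y) atTop (nhds (ENNReal.ofReal (-2 * Real.log (g y)))) :=
      ((ENNReal.continuous_ofReal.tendsto _).comp h1).congr fun n => (hRn n).symm
    rwa [h2.liminf_eq]

/-- The integral of `exp (-r)`, where `r` is the density of the absolutely continuous part of `P`
with respect to `ν`. -/
noncomputable def expCost (ν P : Measure Y) : ℝ := ∫ y, Real.exp (-(P.rnDeriv ν y).toReal) ∂ν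

lemma integrable_exp_neg_toReal {ν : Measure Y} [IsFiniteMeasure ν] {R : Y → ℝ≥0∞}
    (hR : Measurable R) : Integrable (fun y => Real.exp (-(R y).toReal)) ν := by
  refine Integrable.of_bound (Real.measurable_exp.comp hR.ennreal_toReal.neg).aestronglyMeasurable 1
    (Eventually.of_forall fun y => ?_)
  rw [Real.norm_eq_abs, abs_of_pos (Real.exp_pos _)]
  exact Real.exp_le_one_iff.2 (neg_nonpos.2 ENNReal.toReal_nonneg)

lemma expCost_nonneg (ν P : Measure Y) : 0 ≤ expCost ν P :=
  integral_nonneg fun _ => (Real.exp_pos _).le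

/-- The parallelogram identity for the exponential cost, in terms of the square roots
`exp (-r / 2)` of the integrands. -/
lemma integral_sq_sub_exp_half_eq {P P' ν : Measure Y} [IsFiniteMeasure P] [IsFiniteMeasure P']
    [IsFiniteMeasure ν] :
    ∫ y, (Real.exp (-(P.rnDeriv ν y).toReal / 2) - Real.exp (-(P'.rnDeriv ν y).toReal / 2)) ^ 2 ∂ν =
      expCost ν P + expCost ν P' - 2 * expCost ν ((1 / 2 : ℝ≥0) • P + (1 / 2 : ℝ≥0) • P') := by
  have hP := integrable_exp_neg_toReal (ν := ν) (P.measurable_rnDeriv ν)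
  have hP' := integrable_exp_neg_toReal (ν := ν) (P'.measurable_rnDeriv ν)
  have hM := integrable_exp_neg_toReal (ν := ν)
    (((1 / 2 : ℝ≥0) • P + (1 / 2 : ℝ≥0) • P').measurable_rnDeriv ν)
  have h1 : ∫ y, (Real.exp (-(P.rnDeriv ν y).toReal / 2)
      - Real.exp (-(P'.rnDeriv ν y).toReal / 2)) ^ 2 ∂ν =
      ∫ y, ((Real.exp (-(P.rnDeriv ν y).toReal) + Real.exp (-(P'.rnDeriv ν y).toReal)) - 2 * Real.exp
        (-(((1 / 2 : ℝ≥0) • P + (1 / 2 : ℝ≥0) • P').rnDeriv ν y).toReal)) ∂ν := by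
    refine integral_congr_ae ?_
    filter_upwards [Measure.rnDeriv_add ((1 / 2 : ℝ≥0) • P) ((1 / 2 : ℝ≥0) • P') ν,
      Measure.rnDeriv_smul_left' P ν (1 / 2), Measure.rnDeriv_smul_left' P' ν (1 / 2),
      P.rnDeriv_lt_top ν, P'.rnDeriv_lt_top ν] with y h1 h2 h3 h4 h5
    rw [h1, Pi.add_apply, h2, h3, Pi.smul_apply, Pi.smul_apply]
    lift P.rnDeriv ν y to ℝ≥0 using h4.ne with a
    lift P'.rnDeriv ν y to ℝ≥0 using h5.ne with b
    have h6 : ((1 / 2 : ℝ≥0) • (a : ℝ≥0∞) + (1 / 2 : ℝ≥0) • (b : ℝ≥0∞)).toReal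
        = (a : ℝ) / 2 + b / 2 := by
      have : (1 / 2 : ℝ≥0) • (a : ℝ≥0∞) + (1 / 2 : ℝ≥0) • (b : ℝ≥0∞)
          = ((1 / 2 * a + 1 / 2 * b : ℝ≥0) : ℝ≥0∞) := by
        simp only [ENNReal.smul_def, smul_eq_mul, ENNReal.coe_add, ENNReal.coe_mul]
      rw [this, ENNReal.coe_toReal]
      push_cast
      ring
    rw [h6, ENNReal.coe_toReal, ENNReal.coe_toReal]
    have e1 : Real.exp (-(a : ℝ)) = Real.exp (-(a : ℝ) / 2) * Real.exp (-(a : ℝ) / 2) := by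
      rw [← Real.exp_add]; ring_nf
    have e2 : Real.exp (-(b : ℝ)) = Real.exp (-(b : ℝ) / 2) * Real.exp (-(b : ℝ) / 2) := by
      rw [← Real.exp_add]; ring_nf
    have e3 : Real.exp (-((a : ℝ) / 2 + b / 2)) = Real.exp (-(a : ℝ) / 2) * Real.exp (-(b : ℝ) / 2) := by
      rw [← Real.exp_add]; ring_nf
    rw [e1, e2, e3]
    ring
  have h2 := integral_sub (hP.add hP') (hM.const_mul 2)
  rw [integral_const_mul] at h2
  exact h1.trans (h2.trans (congrArg (fun z => z - _) (integral_add hP hP')))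

/-- The function `t ↦ exp (-t)`, a strictly convex function that is bounded on the half-line. -/
noncomputable def expNeg : ℝ≥0 → EReal := fun t => ((Real.exp (-(t : ℝ)) : ℝ) : EReal)

lemma effDomain_expNeg : effDomain expNeg = Set.univ :=
  Set.eq_univ_of_forall fun _ => EReal.coe_ne_top _

lemma isProperFun_expNeg : IsProperFun expNeg :=
  ⟨fun _ => EReal.coe_ne_bot _, by rw [effDomain_expNeg]; exact Set.univ_nonempty⟩

lemma continuous_expNeg : Continuous expNeg :=
  continuous_coe_real_ereal.comp (Real.continuous_exp.comp NNReal.continuous_coe.neg)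

lemma strictConvexOn_expNeg :
    StrictConvexOn ℝ≥0 (effDomain expNeg) (fun t => (expNeg t).toReal) := by
  rw [effDomain_expNeg]
  refine ⟨convex_univ, fun x _ y _ hxy a b ha hb hab => ?_⟩
  have hne : -(x : ℝ) ≠ -(y : ℝ) := fun h => hxy (NNReal.coe_injective (neg_injective h))
  have := strictConvexOn_exp.2 (Set.mem_univ (-(x : ℝ))) (Set.mem_univ (-(y : ℝ))) hne
    (NNReal.coe_pos.2 ha) (NNReal.coe_pos.2 hb) (by exact_mod_cast hab)
  simp only [smul_eq_mul] at this
  simp only [expNeg, EReal.toReal_coe, NNReal.smul_def, smul_eq_mul, NNReal.coe_add, NNReal.coe_mul]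
  convert this using 2
  ring

lemma recessionSlope_expNeg : recessionSlope expNeg = 0 := by
  refine Tendsto.limsup_eq ?_
  have ht : Tendsto (fun t : ℝ≥0 => (t : ℝ)) atTop atTop := NNReal.tendsto_coe_atTop.2 tendsto_id
  have h1 : Tendsto (fun t : ℝ≥0 => Real.exp (-(t : ℝ)) / (t : ℝ)) atTop (nhds 0) := by
    have := (Real.tendsto_exp_neg_atTop_nhds_zero.comp ht).mul (tendsto_inv_atTop_zero.comp ht)
    simpa [div_eq_mul_inv] using this
  have h2 := (continuous_coe_real_ereal.tendsto (0 : ℝ)).comp h1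
  refine h2.congr fun t => ?_
  rw [Function.comp_apply, EReal.coe_div]
  rfl

lemma thetaDivergence_expNeg (P ν : Measure Y) [IsFiniteMeasure ν] :
    thetaDivergence expNeg P ν = (expCost ν P : EReal) := by
  rw [thetaDivergence, recessionSlope_expNeg, zero_mul, add_zero]
  exact extIntegral_eq_coe_integral (Eventually.of_forall fun _ => rfl)
    (integrable_exp_neg_toReal (P.measurable_rnDeriv ν))

end ExponentialCost

lemma half_smul_add_half_smul_mem_liftsAlong {Z X : Type*} [MeasurableSpace Z]
    [MeasurableSpace X] {E : Set Z} {p : Z → X} (hp : Measurable p) {μ : Measure X}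
    {π π' : Measure Z} (hπ : π ∈ liftsAlong E p μ) (hπ' : π' ∈ liftsAlong E p μ) :
    (1 / 2 : ℝ≥0) • π + (1 / 2 : ℝ≥0) • π' ∈ liftsAlong E p μ := by
  have := hπ.1
  have := hπ'.1
  refine ⟨inferInstance, ?_, ?_⟩
  · rw [Measure.add_apply, Measure.smul_apply, Measure.smul_apply, hπ.2.1, hπ'.2.1]
    simp
  · rw [Measure.map_add _ _ hp, Measure.map_smul, Measure.map_smul, hπ.2.2, hπ'.2.2, ← add_smul]
    have : (1 / 2 : ℝ≥0) + 1 / 2 = 1 := add_halves 1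
    rw [this, one_smul]

section Existence

variable {Z X Y : Type*}
  [TopologicalSpace Z] [PolishSpace Z] [MeasurableSpace Z] [BorelSpace Z]
  [TopologicalSpace X] [PolishSpace X] [MeasurableSpace X] [BorelSpace X]
  [TopologicalSpace Y] [PolishSpace Y] [MeasurableSpace Y] [BorelSpace Y]
  {p : Z → X} {q : Z → Y} {E : Set Z}

/-- The exponential cost of the opposite marginal attains its minimum over the lifts of `μ`.  By
the parallelogram identity the densities of a minimizing sequence converge almost everywhere along
a subsequence, and a lift of density at least the limit is a minimizer. -/
theorem exists_expCost_minimizer (hp : Continuous p) (hq : Continuous q)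
    (hproper : ∀ A B, IsCompact A → IsCompact B → IsCompact (p ⁻¹' A ∩ q ⁻¹' B))
    (hE : IsClosed E) (hsurj : ∀ x, ∃ z ∈ E, p z = x)
    (μ : Measure X) [IsFiniteMeasure μ] (ν : Measure Y) [IsFiniteMeasure ν] :
    ∃ π ∈ liftsAlong E p μ, ∀ π' ∈ liftsAlong E p μ,
      expCost ν (π.map q) ≤ expCost ν (π'.map q) := by
  obtain ⟨π₀, hπ₀, -⟩ := exists_mem_liftsAlong_ge hp hE hsurj μ (σ := 0) (by simp)
    (by simpa using Measure.zero_le μ)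
  set V : Set ℝ := (fun π : Measure Z => expCost ν (π.map q)) '' liftsAlong E p μ with hV
  have hVne : V.Nonempty := ⟨_, π₀, hπ₀, rfl⟩
  have hVbdd : BddBelow V := ⟨0, by rintro _ ⟨π, -, rfl⟩; exact expCost_nonneg _ _⟩
  set I := sInf V with hI
  have hIle : ∀ π ∈ liftsAlong E p μ, I ≤ expCost ν (π.map q) := fun π hπ =>
    csInf_le hVbdd ⟨π, hπ, rfl⟩
  have hseq : ∀ n : ℕ, ∃ π ∈ liftsAlong E p μ, expCost ν (π.map q) < I + 1 / ((n : ℝ) + 1) := by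
    intro n
    obtain ⟨_, ⟨π, hπ, rfl⟩, hlt⟩ := exists_lt_of_csInf_lt hVne
      (show I < I + 1 / ((n : ℝ) + 1) from lt_add_of_pos_right _ Nat.one_div_pos_of_nat)
    exact ⟨π, hπ, hlt⟩
  choose π hπ hcost using hseq
  have hπfin : ∀ n, IsFiniteMeasure (π n) := fun n => (hπ n).1
  have hPfin : ∀ n, IsFiniteMeasure ((π n).map q) := fun n => Measure.isFiniteMeasure_map _ _
  set R : ℕ → Y → ℝ≥0∞ := fun n => ((π n).map q).rnDeriv ν with hR
  have hRm : ∀ n, Measurable (R n) := fun n => Measure.measurable_rnDeriv _ _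
  have hcauchy : ∀ n m : ℕ, ∫ y, (Real.exp (-(R n y).toReal / 2) - Real.exp (-(R m y).toReal / 2)) ^ 2
      ∂ν ≤ 1 / ((n : ℝ) + 1) + 1 / ((m : ℝ) + 1) := by
    intro n m
    have h1 := integral_sq_sub_exp_half_eq (P := (π n).map q) (P' := (π m).map q) (ν := ν)
    have h2 := hIle _ (half_smul_add_half_smul_mem_liftsAlong hp.measurable (hπ n) (hπ m))
    rw [Measure.map_add _ _ hq.measurable, Measure.map_smul, Measure.map_smul] at h2
    have h3 := hcost n
    have h4 := hcost m
    linarith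
  obtain ⟨φ, g, hφ, hg⟩ := exists_subseq_tendsto_ae_of_integral_sq_sub_le (ν := ν)
    (u := fun n y => Real.exp (-(R n y).toReal / 2))
    (fun n => Real.measurable_exp.comp ((hRm n).ennreal_toReal.neg.div_const 2))
    (fun n y => by
      rw [abs_of_pos (Real.exp_pos _)]
      refine Real.exp_le_one_iff.2 ?_
      have : 0 ≤ (R n y).toReal := ENNReal.toReal_nonneg
      linarith) hcauchy
  have hlim := ae_tendsto_liminf_of_tendsto_exp (ν := ν) (R := fun n => R (φ n))
    (fun n => hRm _) (fun n => Measure.rnDeriv_lt_top _ _) (measure_ne_top μ Set.univ)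
    (fun n => by
      have h1 := Measure.setLIntegral_rnDeriv_le (μ := (π (φ n)).map q) (ν := ν) Set.univ
      rw [Measure.restrict_univ] at h1
      refine h1.trans (le_of_eq ?_)
      rw [Measure.map_apply hq.measurable MeasurableSet.univ, Set.preimage_univ, ← (hπ (φ n)).2.2,
        Measure.map_apply hp.measurable MeasurableSet.univ, Set.preimage_univ]) hg
  set r : Y → ℝ≥0∞ := fun y => liminf (fun n => R (φ n) y) atTop with hr
  have hrm : Measurable r := Measurable.liminf fun n => hRm _
  obtain ⟨ξ, hξ, hle⟩ := exists_mem_liftsAlong_withDensity_le hp hq hproper hE hsurj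
    (fun n => hπ (φ n)) hrm hlim
  have hξfin : IsFiniteMeasure ξ := hξ.1
  have hξq : IsFiniteMeasure (ξ.map q) := Measure.isFiniteMeasure_map _ _
  refine ⟨ξ, hξ, fun π' hπ' => le_trans ?_ (hIle π' hπ')⟩
  have hlimI : Tendsto (fun n => expCost ν ((π (φ n)).map q)) atTop (nhds I) := by
    have h1 : Tendsto (fun n : ℕ => I + 1 / ((n : ℝ) + 1)) atTop (nhds (I + 0)) :=
      tendsto_const_nhds.add tendsto_one_div_add_atTop_nhds_zero_nat
    rw [add_zero] at h1
    exact tendsto_of_tendsto_of_tendsto_of_le_of_le tendsto_const_nhds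
      (h1.comp hφ.tendsto_atTop) (fun n => hIle _ (hπ _)) fun n => (hcost (φ n)).le
  have hlimr : Tendsto (fun n => expCost ν ((π (φ n)).map q)) atTop
      (nhds (∫ y, Real.exp (-(r y).toReal) ∂ν)) := by
    refine tendsto_integral_of_dominated_convergence (fun _ => (1 : ℝ))
      (fun n => (integrable_exp_neg_toReal (hRm (φ n))).aestronglyMeasurable) (integrable_const _)
      (fun n => Eventually.of_forall fun y => ?_) ?_
    · rw [Real.norm_eq_abs, abs_of_pos (Real.exp_pos _)]
      exact Real.exp_le_one_iff.2 (neg_nonpos.2 ENNReal.toReal_nonneg)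
    · filter_upwards [hlim] with y hy
      exact (Real.continuous_exp.tendsto _).comp ((ENNReal.tendsto_toReal hy.1).comp hy.2).neg
  rw [tendsto_nhds_unique hlimI hlimr]
  refine integral_mono_ae (integrable_exp_neg_toReal (Measure.measurable_rnDeriv _ _))
    (integrable_exp_neg_toReal hrm) ?_
  filter_upwards [rnDeriv_le_rnDeriv_of_le (ν := ν) hle, Measure.rnDeriv_withDensity ν hrm,
    (ξ.map q).rnDeriv_lt_top ν] with y h1 h2 h3
  rw [h2] at h1
  exact Real.exp_le_exp.2 (neg_le_neg (ENNReal.toReal_mono h3.ne h1))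

end Existence

/-! ### Level-optimal refinements -/

section LevelOptimal

variable {Ω : Bool → Type*}

lemma measurable_sideProj [∀ ι, MeasurableSpace (Ω ι)] (ι : Bool) :
    Measurable (sideProj (Ω := Ω) ι) := by
  cases ι
  · exact measurable_fst
  · exact measurable_snd

lemma continuous_sideProj [∀ ι, TopologicalSpace (Ω ι)] (ι : Bool) :
    Continuous (sideProj (Ω := Ω) ι) := by
  cases ι
  · exact continuous_fst
  · exact continuous_snd

lemma isCompact_sideProj_preimage_inter [∀ ι, TopologicalSpace (Ω ι)] (ι : Bool) (A : Set (Ω ι))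
    (B : Set (Ω (!ι))) (hA : IsCompact A) (hB : IsCompact B) :
    IsCompact (sideProj (Ω := Ω) ι ⁻¹' A ∩ sideProj (!ι) ⁻¹' B) := by
  cases ι
  · exact hA.prod hB
  · have : sideProj (Ω := Ω) true ⁻¹' A ∩ sideProj (!true) ⁻¹' B = B ×ˢ A := by
      ext z
      exact and_comm
    rw [this]
    exact hB.prod hA

/-- A minimizer of a strictly convex divergence among the refinements is level-optimal. -/
theorem isLevelOptimalMaximin_of_minimizer [∀ ι, MeasurableSpace (Ω ι)]
    {E : Set (Ω false × Ω true)} {ν : ∀ ι, Measure (Ω ι)} [∀ ι, IsFiniteMeasure (ν ι)] {ι : Bool}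
    {θ : ℝ≥0 → EReal} (hθ : IsProperFun θ) (hmeas : Measurable θ)
    (hf : StrictConvexOn ℝ≥0 (effDomain θ) (fun t => (θ t).toReal))
    {π : Measure (Ω false × Ω true)} (hπ : π ∈ allocationRefinements E ν ι)
    (hmin : ∀ π' ∈ allocationRefinements E ν ι,
      thetaDivergence θ (payload ι π) (ν (!ι)) ≤ thetaDivergence θ (payload ι π') (ν (!ι)))
    (hfin : thetaDivergence θ (payload ι π) (ν (!ι)) < ⊤) : IsLevelOptimalMaximin E ν ι π := by
  refine ⟨hπ, fun t => ?_⟩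
  rw [truncatedPayload, withDensity_apply _ MeasurableSet.univ, Measure.restrict_univ, fitMass]
  refine le_antisymm ?_ (iSup₂_le fun σ hσ => ?_)
  · obtain ⟨σ, h1, h2, h3, h4, h5⟩ := exists_subplan_mass_eq_lintegral_min (ν := ν (!ι))
      (measurable_sideProj ι) (measurable_sideProj (!ι)) hπ t
    exact h5.symm.le.trans (le_iSup₂ (f := fun σ (_ : σ ∈ feasibleSubplans E ν ι t) => σ Set.univ)
      σ ⟨h1, h2, h3, h4⟩)
  · exact measure_univ_le_lintegral_min_of_minimizer (measurable_sideProj ι)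
      (measurable_sideProj (!ι)) hθ hmeas hf hπ hmin hfin hσ.2.1 hσ.2.2.1 hσ.2.2.2

end LevelOptimal

theorem mainTheorem3 {Ω : Bool → Type*}
    [∀ ι, TopologicalSpace (Ω ι)] [∀ ι, PolishSpace (Ω ι)]
    [∀ ι, MeasurableSpace (Ω ι)] [∀ ι, BorelSpace (Ω ι)]
    (E : Set (Ω false × Ω true)) (hE : IsClosed E)
    (hN₁ : ∀ x : Ω false, ∃ y : Ω true, (x, y) ∈ E)
    (hN₀ : ∀ y : Ω true, ∃ x : Ω false, (x, y) ∈ E)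
    (ν : ∀ ι, Measure (Ω ι)) [∀ ι, IsFiniteMeasure (ν ι)] (hν : ∀ ι, 0 < ν ι Set.univ)
    (ι : Bool) :
    (∀ θ : ℝ≥0 → EReal, IsProperFun θ → LowerSemicontinuous θ →
      StrictConvexOn ℝ≥0 (effDomain θ) (fun t => (θ t).toReal) →
      ∀ π : Measure (Ω false × Ω true),
        IsClosestOneSidedRefinement E ν ι (thetaDivergence θ) π →
        thetaDivergence θ (payload ι π) (ν (!ι)) < ⊤ →
        IsLevelOptimalMaximin E ν ι π) ∧
    ∃ π : Measure (Ω false × Ω true), IsLevelOptimalMaximin E ν ι π := by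
  refine ⟨fun θ hθ hlsc hf π hπ hfin => ?_, ?_⟩
  · exact isLevelOptimalMaximin_of_minimizer hθ hlsc.measurable hf hπ.1
      (fun π' hπ' => hπ.2.le.trans (iInf₂_le π' hπ')) hfin
  · have hsurj : ∀ x : Ω ι, ∃ z ∈ E, sideProj ι z = x := by
      cases ι
      · exact fun x => (hN₁ x).imp' (fun y => (x, y)) fun y hy => ⟨hy, rfl⟩
      · exact fun y => (hN₀ y).imp' (fun x => (x, y)) fun x hx => ⟨hx, rfl⟩
    obtain ⟨π, hπ, hmin⟩ := exists_expCost_minimizer (continuous_sideProj ι)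
      (continuous_sideProj (!ι)) (isCompact_sideProj_preimage_inter ι) hE hsurj (ν ι) (ν (!ι))
    refine ⟨π, isLevelOptimalMaximin_of_minimizer isProperFun_expNeg continuous_expNeg.measurable
      strictConvexOn_expNeg hπ (fun π' hπ' => ?_) ?_⟩
    · rw [thetaDivergence_expNeg, thetaDivergence_expNeg]
      exact EReal.coe_le_coe_iff.2 (hmin π' hπ')
    · rw [thetaDivergence_expNeg]
      exact EReal.coe_lt_top _
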